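/- Let $\mathcal G\subset\mathbb R^N$ be a compact, connected embedded metric graph: a union of finitely many vertices and finitely many edges, where each edge is a continuous curve of finite length which joins two (possibly equal) vertices and is injective on its interior, and the open edges contain no vertices and are pairwise disjoint (loops and multiple edges are allowed). For $A\subset\mathbb R^N$ let $d_A(a,b)$ be the infimum of the lengths of the paths in $A$ from $a$ to $b$. Let $\ell(\mathcal G)\in(0,\infty]$ be the length of the shortest simple cycle of $\mathcal G$ ($\infty$ if there is none). For $\varepsilon,R>0$ let $$\delta^\varepsilon_R(\mathcal G)=\sup_{a,b\in\mathcal G,\ d_{\mathcal G}(a,b)\ge R}\frac{d_{\mathcal G}(a,b)}{d_{\mathcal G^\varepsilon}(a,b)},$$ where $\mathcal G^\varepsilon$ is the open Euclidean $\varepsilon$-thickening of $\mathcal G$ (and $\delta^\varepsilon_R(\mathcal G)=0$ if there are no such $a,b$). For $\mathcal S\subset\mathbb R^N$ and $p,q\in\mathcal S$ let $d^\varepsilon_{\mathcal S}(p,q)$ be the infimum of $\sum_{i=0}^{k}\|a_i-a_{i+1}\|$ over all finite sequences $p=a_0,a_1,\dots,a_{k+1}=q$ in $\mathcal S$ with $\|a_i-a_{i+1}\|<\varepsilon$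 for all $i$. Let $\mathcal R^\varepsilon_\beta(\mathcal S)$ be the abstract simplicial complex whose simplices are the non-empty finite subsets of $\mathcal S$ of $d^\varepsilon_{\mathcal S}$-diameter less than $\beta$. **Theorem (Homotopy Reconstruction).** Let $\mathcal G\subset\mathbb R^N$ be a compact, connected embedded metric graph, and fix any $\xi\in(0,\tfrac14)$. For any positive $\beta<\frac{\ell(\mathcal G)}{4}$, let $\varepsilon$ be any positive number with $\varepsilon\le\frac{\beta}{3}$ and $\delta^\varepsilon_\beta(\mathcal G)\le\frac{1+2\xi}{1+\xi}$. If $\mathcal S\subset\mathbb R^N$ is a non-empty set whose Hausdorff distance to $\mathcal G$ satisfies $d_H(\mathcal G,\mathcal S)<\tfrac12\xi\varepsilon$, then the geometric realization of $\mathcal R^\varepsilon_\beta(\mathcal S)$ is homotopy equivalent to $\mathcal G$. -/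

import Mathlib

open scoped ENNReal unitInterval
open ContinuousMap

/-- The length of a curve `γ : [0,1] → E`: the supremum of the lengths of inscribed polygons. -/
noncomputable def curveLength {E : Type*} [MetricSpace E] (γ : I → E) : ℝ≥0∞ :=
  eVariationOn γ Set.univ

/-- The length (shortest path) metric of a subset `A`: the infimum of the lengths of the
paths `[0,1] → A` from `a` to `b` (it is `∞` if there is no such path of finite length). -/
noncomputable def lengthDist {E : Type*} [MetricSpace E] (A : Set E) (a b : E) : ℝ≥0∞ :=
  ⨅ (γ : Path a b) (_ : ∀ t, γ t ∈ A), curveLength γ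

/-- `G` is an embedded metric graph with finitely many vertices and edges. Each edge is a
continuous curve of finite length that starts and ends at a vertex and is injective on the open
interval; open edges contain no vertex and are pairwise disjoint. Loops and multiple edges are
allowed. The length of an edge is its length as a curve in the ambient space. -/
def IsEmbeddedMetricGraph {E : Type*} [MetricSpace E] (G : Set E) : Prop :=
  ∃ (V : Finset E) (m : ℕ) (e : Fin m → C(I, E)),
    (∀ i, e i 0 ∈ V ∧ e i 1 ∈ V) ∧
    (∀ i, Set.InjOn (e i) (Set.Ioo 0 1)) ∧
    (∀ i, ∀ t ∈ Set.Ioo (0 : I) 1, e i t ∉ V) ∧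
    (∀ i j, i ≠ j → Disjoint (e i '' Set.Ioo 0 1) (e j '' Set.Ioo 0 1)) ∧
    (∀ i, curveLength (e i) ≠ ∞) ∧
    G = (V : Set E) ∪ ⋃ i, Set.range (e i)

/-- The systole `ℓ(G)`: the length of the shortest simple cycle (simple closed curve) of `G`,
which is `∞` if there is none. -/
noncomputable def systole {E : Type*} [MetricSpace E] (G : Set E) : ℝ≥0∞ :=
  ⨅ (x : E) (γ : Path x x) (_ : ∀ t, γ t ∈ G) (_ : Set.InjOn γ (Set.Ico 0 1)), curveLength γ

/-- The large-scale distortion `δ^ε_R(G)`: the supremum of `d_G(a,b) / d_{G^ε}(a,b)` over the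
`a, b ∈ G` with `d_G(a,b) ≥ R`, where `G^ε` is the (open) `ε`-thickening of `G`. -/
noncomputable def largeScaleDistortion {E : Type*} [MetricSpace E] (G : Set E) (ε R : ℝ) : ℝ≥0∞ :=
  ⨆ (a ∈ G) (b ∈ G) (_ : ENNReal.ofReal R ≤ lengthDist G a b),
    lengthDist G a b / lengthDist (Metric.thickening ε G) a b

/-- The `ε`-path metric `d^ε_A(p,q)`: the infimum of `∑ dist (a i) (a (i+1))` over the finite
sequences `p = a 0, …, a (k+1) = q` in `A` with all steps shorter than `ε`. -/
noncomputable def epsPathDist {E : Type*} [MetricSpace E] (A : Set E) (ε : ℝ) (p q : A) : ℝ≥0∞ :=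
  ⨅ (k : ℕ) (a : ℕ → A) (_ : a 0 = p) (_ : a (k + 1) = q)
    (_ : ∀ i ≤ k, dist (a i) (a (i + 1)) < ε),
    ∑ i ∈ Finset.range (k + 1), edist (a i) (a (i + 1))

/-- The Vietoris–Rips complex of `(X, d)` at scale `β`: its simplices are the nonempty finite
subsets of `X` of `d`-diameter less than `β`. -/
def vietorisRips {X : Type*} (d : X → X → ℝ≥0∞) (β : ℝ≥0∞) : PreAbstractSimplicialComplex X where
  faces := {s | s.Nonempty ∧ (s.sup fun x => s.sup fun y => d x y) < β}
  isRelLowerSet_faces := fun s hs => ⟨hs.1, fun _ ht hne => ⟨hne, lt_of_le_of_lt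
    (Finset.sup_le fun x hx => Finset.sup_le fun _ hy =>
      (Finset.le_sup (f := fun z => d x z) (ht hy)).trans
        (Finset.le_sup (f := fun z => s.sup fun w => d z w) (ht hx))) hs.2⟩⟩

/-- The `ε`-path Vietoris–Rips complex `R^ε_β(S)`. -/
noncomputable def epsPathRips {E : Type*} [MetricSpace E] (S : Set E) (ε β : ℝ) :
    PreAbstractSimplicialComplex S :=
  vietorisRips (epsPathDist S ε) (ENNReal.ofReal β)

/-- The points of the geometric realization `|K|` of an abstract simplicial complex, given by
their barycentric coordinates. -/
def GeometricRealization {X : Type*} (K : PreAbstractSimplicialComplex X) : Type _ :=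
  {x : X →₀ ℝ // x.support ∈ K.faces ∧ (∀ v, 0 ≤ x v) ∧ (x.sum fun _ r => r) = 1}

/-- The closed simplex `|s| ⊆ |K|` spanned by `s`. -/
def closedSimplex {X : Type*} (K : PreAbstractSimplicialComplex X) (s : Finset X) :
    Set (GeometricRealization K) :=
  {x | x.1.support ⊆ s}

/-- The usual (coherent) topology of `|K|`: a subset is open iff its trace on each closed simplex
`|s|`, `s ∈ K`, is open, where `|s|` carries the topology of the barycentric coordinates. -/
instance GeometricRealization.instTopologicalSpace {X : Type*}
    (K : PreAbstractSimplicialComplex X) : TopologicalSpace (GeometricRealization K) :=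
  ⨆ s : K.faces, TopologicalSpace.coinduced
    (Subtype.val : closedSimplex K s.1 → GeometricRealization K)
    (TopologicalSpace.induced (fun (x : closedSimplex K s.1) (v : X) => x.1.1 v)
      (inferInstance : TopologicalSpace (X → ℝ)))

-- With its length metric, `G` becomes a compact geodesic space `X` homeomorphic to `G`. Its simple
-- loops have length at least 4β, so geodesic triangles with sides shorter than D = 1.3β are
-- tripods: a point of one side missing the other two would lie on a simple loop no longer than the
-- perimeter, which is below 3D (`isTreelike_of_loops`). At scale D the space therefore behaves like
-- a tree. Points between two given points are unique and vary continuously, balls are convex, and a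
-- finite set of diameter below D has a centre within D/2 of its whole hull.
--
-- The sample is related to `X` by "p lies within ξε/2 of x". Adjacent samples correspond to points
-- less than D apart, by the distortion bound (`dist_lt_of_largeScaleDistortion_le`). Conversely,
-- points at distance at most r = 0.68β correspond to adjacent samples, by subdividing a geodesic
-- (`epsPathDist_le_of_isGeodesic`). Since D/2 < r, a sample near the centre of the hull of a
-- simplex is adjacent to every sample sufficiently near that hull.
--
-- The rest is a statement about flag complexes (`nonempty_homotopyEquiv_of_isTreelike`). A map f
-- from the realization to `X` travels successively towards the images of the vertices, and a map g
-- back comes from a partition of unity. The composite f ∘ g moves points by less than D and is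
-- contracted to the identity along geodesics. The composite g ∘ f and the identity share a carrier
-- by cones, so both deform to one map determined by the apexes (`homotopic_of_carrier`). The
-- superlevel sets of the barycentric coordinates of a point form a chain, as in the barycentric
-- subdivision; as a level t rises, the mass below t is handed to the apexes of these sets.

universe u

open Set Filter Topology

/-! ### Continuity criteria for the coherent topology -/

namespace GeometricRealization

variable {X : Type*} {K : PreAbstractSimplicialComplex X}

lemma support_mem (x : GeometricRealization K) : x.1.support ∈ K.faces := x.2.1

lemma coord_nonneg (x : GeometricRealization K) (v : X) : 0 ≤ x.1 v := x.2.2.1 v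

lemma sum_eq_one_of_subset (x : GeometricRealization K) {s : Finset X} (h : x.1.support ⊆ s) :
    ∑ v ∈ s, x.1 v = 1 := by
  refine Eq.trans ?_ x.2.2.2
  exact (Finset.sum_subset h fun v _ hv => by simpa using hv).symm

lemma coord_le_one (x : GeometricRealization K) (v : X) : x.1 v ≤ 1 := by
  by_cases hv : v ∈ x.1.support
  · refine le_trans ?_ (sum_eq_one_of_subset x subset_rfl).le
    exact Finset.single_le_sum (f := fun v => x.1 v) (fun v _ => coord_nonneg x v) hv
  · simp at hv; simp [hv]

/-- The topology of the barycentric coordinates on a closed simplex. -/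
@[reducible]
def coordTopology (s : Finset X) : TopologicalSpace (closedSimplex K s) :=
  TopologicalSpace.induced (fun (x : closedSimplex K s) (v : X) => x.1.1 v)
      (inferInstance : TopologicalSpace (X → ℝ))

lemma continuous_iff {Y : Type*} [TopologicalSpace Y] {f : GeometricRealization K → Y} :
    Continuous f ↔ ∀ s ∈ K.faces,
      @Continuous _ _ (coordTopology s) _ (fun x : closedSimplex K s => f x.1) := by
  rw [continuous_iSup_dom]
  simp only [continuous_coinduced_dom, Subtype.forall]
  rfl

lemma continuous_closedSimplex {s : Finset X} (hs : s ∈ K.faces) :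
    @Continuous _ _ (coordTopology s) _ (Subtype.val : closedSimplex K s → _) :=
  continuous_iff.1 continuous_id s hs

lemma continuous_coord (v : X) : Continuous fun x : GeometricRealization K => x.1 v := by
  rw [continuous_iff]
  intro s _
  let _ := coordTopology (K := K) s
  exact (continuous_apply v).comp continuous_induced_dom

lemma continuous_closedSimplex_coord (s : Finset X) (v : X) :
    @Continuous _ _ (coordTopology s) _ (fun x : closedSimplex K s => x.1.1 v) := by
  let _ := coordTopology (K := K) s
  exact (continuous_apply v).comp continuous_induced_dom

/-- The product with a locally compact space still has the coherent topology. Currying reduces the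
claim to a map into `C(Z, Y)`, whose continuity is tested simplex by simplex; local compactness
allows uncurrying. This is what makes homotopies checkable on simplices. -/
lemma continuous_prod_iff {Y Z : Type*} [TopologicalSpace Y] [TopologicalSpace Z]
    [LocallyCompactSpace Z] {f : GeometricRealization K × Z → Y} :
    Continuous f ↔ ∀ s ∈ K.faces,
      @Continuous _ _ (@instTopologicalSpaceProd _ _ (coordTopology s) _) _
        (fun x : closedSimplex K s × Z => f (x.1.1, x.2)) := by
  constructor
  · intro h s hs
    let _ := coordTopology (K := K) s
    exact h.comp (((continuous_closedSimplex hs).comp continuous_fst).prodMk continuous_snd)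
  · intro h
    have hz : ∀ x : GeometricRealization K, Continuous fun z => f (x, z) := by
      intro x
      let _ := coordTopology (K := K) x.1.support
      exact (h _ x.support_mem).comp
        (Continuous.prodMk_right (⟨x, Finset.Subset.refl _⟩ : closedSimplex K x.1.support))
    let F : GeometricRealization K → C(Z, Y) := fun x => ⟨fun z => f (x, z), hz x⟩
    have hF : Continuous F := by
      rw [continuous_iff]
      intro s hs
      let _ := coordTopology (K := K) s
      exact ContinuousMap.continuous_of_continuous_uncurry _ (h s hs)
    exact ContinuousMap.continuous_uncurry_of_continuous ⟨F, hF⟩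

/-- A map into a realization that only involves finitely many vertices is continuous as soon as
its coordinates are. -/
lemma continuous_of_coord {Z : Type*} [TopologicalSpace Z] {φ : Z → GeometricRealization K}
    (F : Finset X) (hF : ∀ z, (φ z).1.support ⊆ F) (hφ : ∀ v ∈ F, Continuous fun z => (φ z).1 v) :
    Continuous φ := by
  classical
  have hφ' : ∀ v, Continuous fun z => (φ z).1 v := by
    intro v
    by_cases hv : v ∈ F
    · exact hφ v hv
    · have : (fun z => (φ z).1 v) = fun _ => 0 := by
        ext z
        have := fun h => hv (hF z h)
        simpa using this
      rw [this]; exact continuous_const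
  let A : (F.powerset.filter (· ∈ K.faces) : Finset (Finset X)) → Set Z := fun s => {z | (φ z).1.support ⊆ s.1}
  have hA : LocallyFinite A := locallyFinite_of_finite A
  refine hA.continuous ?_ ?_ ?_
  · rw [eq_univ_iff_forall]
    intro z
    exact mem_iUnion.2 ⟨⟨(φ z).1.support, Finset.mem_filter.2 ⟨Finset.mem_powerset.2 (hF z), (φ z).support_mem⟩⟩,
      Finset.Subset.refl _⟩
  · intro s
    have : A s = ⋂ v ∉ s.1, {z | (φ z).1 v = 0} := by
      ext z
      simp only [A, mem_ofPred_eq, mem_iInter]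
      constructor
      · intro h v hv
        by_contra h'
        exact hv (h (Finsupp.mem_support_iff.2 h'))
      · intro h v hv
        by_contra h'
        exact Finsupp.mem_support_iff.1 hv (h v h')
    rw [this]
    exact isClosed_biInter fun v _ => isClosed_eq (hφ' v) continuous_const
  · intro s
    rw [continuousOn_iff_continuous_domRestrict]
    have hs : s.1 ∈ K.faces := (Finset.mem_filter.1 s.2).2
    let _ := coordTopology (K := K) s.1
    let ψ : A s → closedSimplex K s.1 := fun z => ⟨φ z.1, z.2⟩
    have : Continuous ψ := continuous_induced_rng.2
      (continuous_pi fun v => (hφ' v).comp continuous_subtype_val)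
    exact (continuous_closedSimplex hs).comp this

end GeometricRealization

/-! ### Superlevel sets of barycentric coordinates -/

namespace LevelSet

variable {X : Type*}

/-- The superlevel set `{v | u < x v}` of a finitely supported function, inside its support. -/
noncomputable def level (x : X →₀ ℝ) (u : ℝ) : Finset X :=
  x.support.filter (fun v => u < x v)

lemma mem_level {x : X →₀ ℝ} {u : ℝ} (hu : 0 ≤ u) {v : X} : v ∈ level x u ↔ u < x v := by
  simp only [level, Finset.mem_filter, Finsupp.mem_support_iff, and_iff_right_iff_imp]
  intro h h0
  linarith

lemma level_anti (x : X →₀ ℝ) {u u' : ℝ} (h : u ≤ u') : level x u' ⊆ level x u := by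
  intro v hv
  simp only [level, Finset.mem_filter] at hv ⊢
  exact ⟨hv.1, h.trans_lt hv.2⟩

lemma level_subset (x : X →₀ ℝ) (u : ℝ) : level x u ⊆ x.support := Finset.filter_subset _ _

lemma level_eq_iff {x : X →₀ ℝ} {s τ : Finset X} (hx : x.support ⊆ s) (hτ : τ ⊆ s) {u : ℝ}
    (hu : 0 ≤ u) : level x u = τ ↔ ∀ v ∈ s, (v ∈ τ ↔ u < x v) := by
  constructor
  · rintro rfl v _
    exact mem_level hu
  · intro h
    ext v
    by_cases hv : v ∈ s
    · rw [mem_level hu, h v hv]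
    · exact iff_of_false (fun h' => hv (hx (level_subset _ _ h'))) (fun h' => hv (hτ h'))

open Classical in
/-- The length of the set of levels `u ∈ [0, t)` at which the superlevel set of `x` is `τ`. -/
noncomputable def duration (x : X →₀ ℝ) (t : ℝ) (τ : Finset X) : ℝ :=
  ∫ u in (0 : ℝ)..1, if u < t ∧ level x u = τ then 1 else 0

lemma duration_nonneg (x : X →₀ ℝ) (t : ℝ) (τ : Finset X) : 0 ≤ duration x t τ := by
  classical
  refine intervalIntegral.integral_nonneg zero_le_one fun u _ => ?_
  split_ifs <;> norm_num

lemma exists_of_duration_ne_zero {x : X →₀ ℝ} {t : ℝ} {τ : Finset X} (h : duration x t τ ≠ 0) :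
    ∃ u, 0 ≤ u ∧ u < t ∧ level x u = τ := by
  classical
  by_contra! H
  apply h
  rw [duration, intervalIntegral.integral_congr (g := fun _ => (0 : ℝ))]
  · simp
  · intro u hu
    rw [uIcc_of_le zero_le_one] at hu
    simp only [ite_eq_right_iff, one_ne_zero, imp_false, not_and]
    exact fun h1 => H u hu.1 h1

lemma measurableSet_level (x : X →₀ ℝ) (t : ℝ) {τ : Finset X} :
    MeasurableSet {u : ℝ | u < t ∧ level x u = τ} := by
  by_cases hτ : τ ⊆ x.support
  · have : {u : ℝ | u < t ∧ level x u = τ} =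
        {u | u < t} ∩ ⋂ v ∈ x.support, {u | (v ∈ τ ↔ u < x v)} := by
      ext u
      simp only [mem_ofPred_eq, mem_inter_iff, mem_iInter]
      refine and_congr_right fun _ => ?_
      constructor
      · rintro rfl v hv
        simp [level, Finsupp.mem_support_iff.1 hv]
      · intro h
        ext v
        by_cases hv : v ∈ x.support
        · rw [h v hv]; simp [level, Finsupp.mem_support_iff.1 hv]
        · exact iff_of_false (fun h' => hv (level_subset _ _ h')) (fun h' => hv (hτ h'))
    rw [this]
    refine measurableSet_Iio.inter (Finset.measurableSet_biInter _ fun v _ => ?_)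
    by_cases hv : v ∈ τ
    · simp only [hv, true_iff]; exact measurableSet_Iio
    · simp only [hv, false_iff, not_lt]; exact measurableSet_Ici
  · convert MeasurableSet.empty
    ext u
    simp only [mem_ofPred_eq, mem_empty_iff_false, iff_false, not_and]
    rintro _ rfl
    exact hτ (level_subset _ _)

open Classical in
lemma intervalIntegrable_ite {p : ℝ → Prop} (hp : MeasurableSet {u | p u}) (r : ℝ) (a b : ℝ) :
    IntervalIntegrable (fun u => if p u then r else 0) MeasureTheory.volume a b := by
  have : (fun u => if p u then r else 0) = {u | p u}.indicator (fun _ => r) := by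
    ext u; simp [Set.indicator_apply]
  rw [this, intervalIntegrable_iff]
  exact MeasureTheory.IntegrableOn.indicator (by simp) hp

lemma integral_ite_lt {a : ℝ} (h0 : 0 ≤ a) (h1 : a ≤ 1) :
    (∫ u in (0 : ℝ)..1, if u < a then (1 : ℝ) else 0) = a := by
  have hi : ∀ b c : ℝ, IntervalIntegrable (fun u => if u < a then (1 : ℝ) else 0)
      MeasureTheory.volume b c := fun b c => by
    have := intervalIntegrable_ite (p := fun u => u < a) measurableSet_Iio 1 b c
    convert this
  rw [← intervalIntegral.integral_add_adjacent_intervals (hi 0 a) (hi a 1),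
    intervalIntegral.integral_congr_ae (g := fun _ => (1 : ℝ)),
    intervalIntegral.integral_congr (a := a) (g := fun _ => (0 : ℝ))]
  · simp
  · intro u hu
    rw [uIcc_of_le h1] at hu
    simp [hu.1]
  · have : ∀ᵐ u : ℝ, u ≠ a := by simp [MeasureTheory.ae_iff]
    filter_upwards [this] with u hu hu'
    rw [uIoc_of_le h0] at hu'
    simp [lt_of_le_of_ne hu'.2 hu]

/-- Layer-cake formula: at each level `u < t` exactly one `τ` contributes, namely the superlevel
set, and it contributes the number of `v` with `u < x v`. Integrating over `u` gives the mass of `x`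
below level `t`. -/
lemma sum_card_mul_duration {x : X →₀ ℝ} {s : Finset X} (hs : x.support ⊆ s) {t : ℝ}
    (ht0 : 0 ≤ t) (ht1 : t ≤ 1) (hx : ∀ v, 0 ≤ x v) :
    ∑ τ ∈ s.powerset, (τ.card : ℝ) * duration x t τ = ∑ v ∈ s, min t (x v) := by
  classical
  have h1 : ∀ τ : Finset X, (τ.card : ℝ) * duration x t τ =
      ∫ u in (0 : ℝ)..1, if u < t ∧ level x u = τ then (τ.card : ℝ) else 0 := by
    intro τ
    rw [duration, ← intervalIntegral.integral_const_mul]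
    congr 1; ext u; split_ifs <;> simp
  have h2 : ∀ v, min t (x v) = ∫ u in (0 : ℝ)..1, if u < min t (x v) then (1 : ℝ) else 0 :=
    fun v => (integral_ite_lt (le_min ht0 (hx v)) ((min_le_left _ _).trans ht1)).symm
  rw [Finset.sum_congr rfl fun τ _ => h1 τ, Finset.sum_congr rfl fun v _ => h2 v,
    ← intervalIntegral.integral_finsetSum, ← intervalIntegral.integral_finsetSum]
  · refine intervalIntegral.integral_congr fun u hu => ?_
    rw [uIcc_of_le zero_le_one] at hu
    simp only [lt_min_iff]
    by_cases hut : u < t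
    · simp only [hut, true_and]
      rw [Finset.sum_ite_eq, if_pos (Finset.mem_powerset.2 ((level_subset _ _).trans hs)),
        Finset.sum_boole]
      congr 2
      ext v
      simp only [mem_level hu.1, Finset.mem_filter]
      exact ⟨fun h => ⟨hs (level_subset x u ((mem_level hu.1).2 h)), h⟩, fun h => h.2⟩
    · simp [hut]
  · intro v _
    have := intervalIntegrable_ite (p := fun u => u < min t (x v)) measurableSet_Iio 1 0 1
    convert this
  · intro τ _
    have := intervalIntegrable_ite (measurableSet_level x t (τ := τ)) (τ.card : ℝ) 0 1
    convert this

-- Dominated convergence: for `u` outside the finite set formed by `t` and the values `y v`, the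
-- integrand is locally constant in the parameters.
open Classical in
lemma continuous_integral_level {ι : Type*} [Finite ι] (τ : Set ι) :
    Continuous fun p : (ι → ℝ) × ℝ =>
      ∫ u in (0 : ℝ)..1, if u < p.2 ∧ ∀ v, (v ∈ τ ↔ u < p.1 v) then (1 : ℝ) else 0 := by
  have : Fintype ι := Fintype.ofFinite ι
  rw [continuous_iff_continuousAt]
  rintro ⟨y, t⟩
  refine intervalIntegral.continuousAt_of_dominated_interval (bound := fun _ => 1) ?_ ?_ ?_ ?_
  · refine Eventually.of_forall fun p => ?_
    refine Measurable.aestronglyMeasurable (Measurable.ite ?_ measurable_const measurable_const)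
    refine measurableSet_Iio.inter ?_
    have : {u | ∀ v, (v ∈ τ ↔ u < p.1 v)} = ⋂ v, {u | (v ∈ τ ↔ u < p.1 v)} := by ext; simp
    change MeasurableSet {u | ∀ v, (v ∈ τ ↔ u < p.1 v)}
    rw [this]
    refine MeasurableSet.iInter fun v => ?_
    by_cases hv : v ∈ τ
    · simp only [hv, true_iff]; exact measurableSet_Iio
    · simp only [hv, false_iff, not_lt]; exact measurableSet_Ici
  · refine Eventually.of_forall fun p => Eventually.of_forall fun u _ => ?_
    split_ifs <;> simp
  · exact intervalIntegrable_const
  · have h1 : ∀ᵐ u : ℝ, u ≠ t := by simp [MeasureTheory.ae_iff]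
    have h2 : ∀ᵐ u : ℝ, ∀ v, u ≠ y v := by
      rw [MeasureTheory.ae_all_iff]; intro v; simp [MeasureTheory.ae_iff]
    filter_upwards [h1, h2] with u hu1 hu2 _
    have key : ∀ {f : (ι → ℝ) × ℝ → ℝ}, Continuous f → u ≠ f (y, t) →
        ∀ᶠ p in 𝓝 (y, t), (u < f p ↔ u < f (y, t)) := by
      intro f hf hne
      rcases hne.lt_or_gt with h | h
      · filter_upwards [hf.continuousAt.eventually_const_lt h] with p hp
        exact iff_of_true hp h
      · filter_upwards [hf.continuousAt.eventually_lt_const h] with p hp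
        exact iff_of_false hp.not_gt h.not_gt
    have e1 := key continuous_snd hu1
    have e2 := eventually_all.2 fun v =>
      key ((continuous_apply v).comp continuous_fst) (hu2 v)
    refine ContinuousAt.congr (f := fun _ => if u < t ∧ ∀ v, (v ∈ τ ↔ u < y v) then (1 : ℝ) else 0)
      continuousAt_const ?_
    filter_upwards [e1, e2] with p hp1 hp2
    simp only [Function.comp_apply] at hp2
    simp only [hp1, hp2]

lemma duration_eq {x : X →₀ ℝ} {s τ : Finset X} (hx : x.support ⊆ s) (hτ : τ ⊆ s) (t : ℝ) :
    duration x t τ = (open Classical in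
      ∫ u in (0 : ℝ)..1, if u < t ∧ ∀ v : s, (v ∈ {v : s | v.1 ∈ τ} ↔ u < x v) then (1 : ℝ)
        else 0) := by
  classical
  refine intervalIntegral.integral_congr fun u hu => ?_
  rw [uIcc_of_le zero_le_one] at hu
  simp only [level_eq_iff hx hτ hu.1, mem_ofPred_eq, Subtype.forall]

lemma continuous_duration {Z : Type*} [TopologicalSpace Z] {x : Z → X →₀ ℝ} {t : Z → ℝ}
    {s τ : Finset X} (hs : ∀ z, (x z).support ⊆ s) (hτ : τ ⊆ s)
    (hx : ∀ v, Continuous fun z => x z v) (ht : Continuous t) :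
    Continuous fun z => duration (x z) (t z) τ := by
  classical
  simp only [duration_eq (hs _) hτ]
  refine ((continuous_integral_level {v : s | v.1 ∈ τ}).comp
    ((continuous_pi fun v : s => hx v).prodMk ht)).congr fun z => ?_
  refine intervalIntegral.integral_congr fun u _ => ?_
  congr!

lemma duration_eq_zero {x : X →₀ ℝ} {τ : Finset X} (h : ¬ τ ⊆ x.support) (t : ℝ) :
    duration x t τ = 0 := by
  by_contra h'
  obtain ⟨u, -, -, rfl⟩ := exists_of_duration_ne_zero h'
  exact h (level_subset _ _)

end LevelSet

/-- Needed where the mass above the level tends to 0: the normalized remainder has no limit there,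
but its coordinates stay bounded. -/
lemma continuous_mul_of_bounded {Z : Type*} [TopologicalSpace Z] {f b : Z → ℝ}
    (hf : Continuous f) (hb : ∀ z, |b z| ≤ 1) (hfb : ContinuousOn b {z | f z ≠ 0}) :
    Continuous fun z => f z * b z := by
  rw [continuous_iff_continuousAt]
  intro z
  by_cases hz : f z = 0
  · have h0 : Tendsto (fun z => |f z|) (𝓝 z) (𝓝 0) := by
      simpa [hz] using hf.abs.tendsto z
    have : Tendsto (fun z => f z * b z) (𝓝 z) (𝓝 0) :=
      squeeze_zero_norm (fun y => by
        rw [Real.norm_eq_abs, abs_mul]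
        exact mul_le_of_le_one_right (abs_nonneg _) (hb y)) h0
    simpa [ContinuousAt, hz] using this
  · exact hf.continuousAt.mul
      (hfb.continuousAt ((isOpen_ne_fun hf continuous_const).mem_nhds hz))

/-! ### Homotopies of maps carried by cones -/

namespace GeometricRealization

open LevelSet

variable {X : Type*} {K : PreAbstractSimplicialComplex X}

/-- The part of `x` above level `t`. -/
noncomputable def cutVec (x : X →₀ ℝ) (t : I) : X →₀ ℝ :=
  x.mapRange (fun r => max (r - t) 0) (by simp [t.2.1])

lemma cutVec_apply (x : X →₀ ℝ) (t : I) (v : X) : cutVec x t v = max (x v - t) 0 := rfl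

lemma support_cutVec (x : X →₀ ℝ) (t : I) : (cutVec x t).support = level x t := by
  ext v
  rw [mem_level t.2.1, Finsupp.mem_support_iff, cutVec_apply]
  constructor
  · intro h
    by_contra h'
    exact h (max_eq_right (by linarith))
  · intro h h'
    have := le_max_left (x v - t) 0
    linarith

/-- The total mass of `x` above level `t`. -/
noncomputable def cutMass (x : X →₀ ℝ) (t : I) : ℝ := ∑ v ∈ x.support, cutVec x t v

lemma cutMass_eq {x : X →₀ ℝ} {s : Finset X} (hs : x.support ⊆ s) (t : I) :
    cutMass x t = ∑ v ∈ s, max (x v - t) 0 :=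
  Finset.sum_subset hs fun v _ hv => by simp_all [cutVec_apply, t.2.1]

lemma cutMass_nonneg (x : X →₀ ℝ) (t : I) : 0 ≤ cutMass x t :=
  Finset.sum_nonneg fun _ _ => le_max_right _ _

lemma level_mem_faces (x : GeometricRealization K) {u : ℝ} (h : (level x.1 u).Nonempty) :
    level x.1 u ∈ K.faces :=
  (K.isRelLowerSet_faces x.support_mem).2 (level_subset _ _) h

open Classical in
/-- The part of `x` above level `t`, normalized to a point of the realization (if nonzero). -/
noncomputable def cutPoint (x : GeometricRealization K) (t : I) : GeometricRealization K :=
  if h : cutMass x.1 t ≠ 0 then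
    ⟨(cutMass x.1 t)⁻¹ • cutVec x.1 t, by
      rw [Finsupp.support_smul_eq (inv_ne_zero h), support_cutVec]
      refine ⟨level_mem_faces x ?_, fun v => ?_, ?_⟩
      · rw [← support_cutVec, Finsupp.support_nonempty_iff]
        intro h'
        exact h (by simp [cutMass, h'])
      · exact mul_nonneg (inv_nonneg.2 (cutMass_nonneg _ _)) (le_max_right _ _)
      · rw [Finsupp.sum_of_support_subset (s := x.1.support) _
          (Finsupp.support_smul.trans (by rw [support_cutVec]; exact level_subset _ _)) _
          (by simp)]
        simp only [Finsupp.smul_apply, smul_eq_mul]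
        rw [← Finset.mul_sum]
        exact inv_mul_cancel₀ h⟩
  else x

lemma cutPoint_val {x : GeometricRealization K} {t : I} (h : cutMass x.1 t ≠ 0) :
    (cutPoint x t).1 = (cutMass x.1 t)⁻¹ • cutVec x.1 t :=
  congrArg Subtype.val (dif_pos h)

lemma support_cutPoint {x : GeometricRealization K} {t : I} (h : cutMass x.1 t ≠ 0) :
    (cutPoint x t).1.support = level x.1 t := by
  rw [cutPoint_val h, Finsupp.support_smul_eq (inv_ne_zero h), support_cutVec]

lemma support_cutPoint_subset (x : GeometricRealization K) (t : I) :
    (cutPoint x t).1.support ⊆ x.1.support := by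
  by_cases h : cutMass x.1 t ≠ 0
  · rw [support_cutPoint h]; exact level_subset _ _
  · rw [show cutPoint x t = x from dif_neg h]

/-- Interpolates between `φ x` (at `t = 0`) and a point that depends on `φ` no longer (at `t = 1`):
the mass of `x` below level `t` is moved to the vertices `c τ`, where `τ` runs over the
superlevel sets of `x`, and `φ` is applied to the rest. -/
noncomputable def pushVec (c : Finset X → X) (φ : GeometricRealization K → GeometricRealization K)
    (x : GeometricRealization K) (t : I) : X →₀ ℝ :=
  cutMass x.1 t • (φ (cutPoint x t)).1 +
    ∑ τ ∈ x.1.support.powerset, Finsupp.single (c τ) (τ.card * duration x.1 t τ)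

lemma pushVec_eq (c : Finset X → X) (φ : GeometricRealization K → GeometricRealization K)
    (x : GeometricRealization K) (t : I) {s : Finset X} (hs : x.1.support ⊆ s) :
    pushVec c φ x t = cutMass x.1 t • (φ (cutPoint x t)).1 +
      ∑ τ ∈ s.powerset, Finsupp.single (c τ) (τ.card * duration x.1 t τ) := by
  rw [pushVec]
  congr 1
  refine Finset.sum_subset (Finset.powerset_mono.2 hs) fun τ _ hτ => ?_
  rw [duration_eq_zero (fun h => hτ (Finset.mem_powerset.2 h))]
  simp

lemma pushVec_nonneg (c : Finset X → X) (φ : GeometricRealization K → GeometricRealization K)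
    (x : GeometricRealization K) (t : I) (v : X) : 0 ≤ pushVec c φ x t v := by
  classical
  simp only [pushVec, Finsupp.add_apply, Finsupp.smul_apply, Finsupp.finsetSum_apply, smul_eq_mul]
  refine add_nonneg (mul_nonneg (cutMass_nonneg _ _) (coord_nonneg _ _))
    (Finset.sum_nonneg fun τ _ => ?_)
  rw [Finsupp.single_apply]
  split_ifs
  · exact mul_nonneg (Nat.cast_nonneg _) (duration_nonneg _ _ _)
  · exact le_rfl

lemma pushVec_sum (c : Finset X → X) (φ : GeometricRealization K → GeometricRealization K)
    (x : GeometricRealization K) (t : I) : ((pushVec c φ x t).sum fun _ r => r) = 1 := by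
  have h1 : ((φ (cutPoint x t)).1.sum fun _ r => r) = 1 := (φ (cutPoint x t)).2.2.2
  have hlin : ∀ f : X →₀ ℝ, (f.sum fun _ r => r) = Finsupp.linearCombination ℝ (fun _ => (1 : ℝ)) f := by
    intro f; simp [Finsupp.linearCombination_apply]
  rw [hlin] at h1 ⊢
  simp only [pushVec, map_add, map_smul, map_sum, h1, Finsupp.linearCombination_single,
    smul_eq_mul, mul_one]
  rw [sum_card_mul_duration subset_rfl t.2.1 t.2.2 (coord_nonneg x), cutMass_eq subset_rfl,
    ← Finset.sum_add_distrib]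
  refine Eq.trans (Finset.sum_congr rfl fun v _ => ?_) (sum_eq_one_of_subset x subset_rfl)
  rcases le_total (t : ℝ) (x.1 v) with h | h
  · rw [min_eq_left h, max_eq_left (by linarith)]; ring
  · rw [min_eq_right h, max_eq_right (by linarith)]; ring

lemma mem_support_pushVec {c : Finset X → X} {φ : GeometricRealization K → GeometricRealization K}
    {x : GeometricRealization K} {t : I} {p : X} (hp : p ∈ (pushVec c φ x t).support) :
    (cutMass x.1 t ≠ 0 ∧ p ∈ (φ (cutPoint x t)).1.support) ∨
      ∃ u, u < (t : ℝ) ∧ (level x.1 u).Nonempty ∧ p = c (level x.1 u) := by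
  classical
  by_contra! H
  rw [Finsupp.mem_support_iff, pushVec] at hp
  apply hp
  simp only [Finsupp.add_apply, Finsupp.smul_apply, Finsupp.finsetSum_apply, smul_eq_mul]
  rw [Finset.sum_eq_zero, add_zero]
  · by_cases h : cutMass x.1 t = 0
    · rw [h, zero_mul]
    · rw [Finsupp.notMem_support_iff.1 (H.1 h), mul_zero]
  · intro τ _
    rw [Finsupp.single_apply]
    split_ifs with h
    · by_contra h'
      obtain ⟨u, h0, hu, rfl⟩ := exists_of_duration_ne_zero (right_ne_zero_of_mul h')
      refine H.2 u hu ?_ h.symm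
      rw [← Finset.card_ne_zero]
      exact_mod_cast left_ne_zero_of_mul h'
    · rfl

/-- `c` and `V` provide a carrier for self-maps of a flag complex: the full subcomplexes on the
vertex sets `V ρ` are cones, compatibly with inclusions of simplices. -/
structure IsConeCarrier (K : PreAbstractSimplicialComplex X) (adj : X → X → Prop)
    (c : Finset X → X) (V : Finset X → Set X) : Prop where
  flag : ∀ s : Finset X, s ∈ K.faces ↔ s.Nonempty ∧ ∀ p ∈ s, ∀ q ∈ s, adj p q
  symm : ∀ p q, adj p q → adj q p
  adj_apex : ∀ τ ∈ K.faces, ∀ ρ ∈ K.faces, τ ⊆ ρ → ∀ p ∈ V τ, adj p (c ρ)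
  apex_adj : ∀ τ ∈ K.faces, ∀ ρ ∈ K.faces, τ ⊆ ρ → adj (c τ) (c ρ)

variable {adj : X → X → Prop} {c : Finset X → X} {V : Finset X → Set X}

/-- By flagness it suffices to compare pairs of vertices. Superlevel sets are nested, so their
apexes are adjacent. The remaining mass sits on the superlevel set at `t`, which is contained in
those at lower levels `u`; hence the vertices of its image are adjacent to the apexes belonging to
such `u`. -/
lemma support_pushVec_mem (hC : IsConeCarrier K adj c V)
    {φ : GeometricRealization K → GeometricRealization K}
    (hφ : ∀ x, ∀ p ∈ (φ x).1.support, p ∈ V x.1.support) (x : GeometricRealization K) (t : I) :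
    (pushVec c φ x t).support ∈ K.faces := by
  rw [hC.flag]
  constructor
  · rw [Finsupp.support_nonempty_iff]
    intro h
    have := pushVec_sum c φ x t
    simp [h] at this
  · have key : ∀ u u', (level x.1 u).Nonempty → (level x.1 u').Nonempty →
        adj (c (level x.1 u)) (c (level x.1 u')) := by
      intro u u' hu hu'
      rcases le_total u u' with h | h
      · exact hC.symm _ _ (hC.apex_adj _ (level_mem_faces x hu') _ (level_mem_faces x hu)
          (level_anti _ h))
      · exact hC.apex_adj _ (level_mem_faces x hu) _ (level_mem_faces x hu') (level_anti _ h)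
    have key2 : ∀ p ∈ (φ (cutPoint x t)).1.support, cutMass x.1 t ≠ 0 → ∀ u < (t : ℝ),
        (level x.1 u).Nonempty → adj p (c (level x.1 u)) := by
      intro p hp hm u hu hne
      have h1 := hφ _ p hp
      refine hC.adj_apex _ (support_mem _) _ (level_mem_faces x hne) ?_ p h1
      rw [support_cutPoint hm]
      exact level_anti _ hu.le
    intro p hp q hq
    rcases mem_support_pushVec hp with ⟨hm, hp⟩ | ⟨u, hu, hne, rfl⟩ <;>
    rcases mem_support_pushVec hq with ⟨hm', hq⟩ | ⟨u', hu', hne', rfl⟩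
    · exact ((hC.flag _).1 (support_mem (φ (cutPoint x t)))).2 p hp q hq
    · exact key2 p hp hm u' hu' hne'
    · exact hC.symm _ _ (key2 q hq hm' u hu hne)
    · exact key _ _ hne hne'

lemma continuousOn_cutPoint {s : Finset X} :
    @ContinuousOn _ _ (@instTopologicalSpaceProd _ _ (coordTopology s) _) _
      (fun z : closedSimplex K s × I => cutPoint z.1.1 z.2) {z | cutMass z.1.1.1 z.2 ≠ 0} := by
  let _ := coordTopology (K := K) s
  rw [continuousOn_iff_continuous_domRestrict]
  have h1 : ∀ v, Continuous fun z : closedSimplex K s × I => z.1.1.1 v := fun v =>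
    (continuous_closedSimplex_coord s v).comp continuous_fst
  have h2 : Continuous fun z : closedSimplex K s × I => (z.2 : ℝ) := by fun_prop
  have h3 : Continuous fun z : closedSimplex K s × I => cutMass z.1.1.1 z.2 := by
    simp only [fun z : closedSimplex K s × I => cutMass_eq z.1.2 z.2]
    exact continuous_finsetSum _ fun v _ => ((h1 v).sub h2).max continuous_const
  refine continuous_of_coord s (fun z => (support_cutPoint_subset _ _).trans z.1.1.2) fun v _ => ?_
  have : (fun z : {z : closedSimplex K s × I | cutMass z.1.1.1 z.2 ≠ 0} =>
      (Set.domRestrict _ (fun z : closedSimplex K s × I => cutPoint z.1.1 z.2) z).1 v) =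
      fun z => (cutMass z.1.1.1.1 z.1.2)⁻¹ * max (z.1.1.1.1 v - (z.1.2 : ℝ)) 0 := by
    ext z
    simp only [Set.domRestrict_apply]
    rw [cutPoint_val z.2]
    rfl
  rw [this]
  exact ((h3.comp continuous_subtype_val).inv₀ fun z => z.2).mul
    ((((h1 v).sub h2).max continuous_const).comp continuous_subtype_val)

lemma exists_homotopy_of_carrier (hC : IsConeCarrier K adj c V)
    {φ : C(GeometricRealization K, GeometricRealization K)}
    (hφ : ∀ x, ∀ p ∈ (φ x).1.support, p ∈ V x.1.support)
    (hφF : ∀ s ∈ K.faces, ∃ F : Finset X, ∀ x : GeometricRealization K, x.1.support ⊆ s →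
      (φ x).1.support ⊆ F) :
    ∃ H : C(GeometricRealization K × I, GeometricRealization K),
      ∀ x t, (H (x, t)).1 = pushVec c φ x t := by
  classical
  let H : GeometricRealization K × I → GeometricRealization K := fun z =>
    ⟨pushVec c φ z.1 z.2, support_pushVec_mem hC hφ z.1 z.2,
      pushVec_nonneg _ _ _ _, pushVec_sum _ _ _ _⟩
  refine ⟨⟨H, ?_⟩, fun _ _ => rfl⟩
  rw [continuous_prod_iff]
  intro s hs
  obtain ⟨F, hF⟩ := hφF s hs
  let _ := coordTopology (K := K) s
  have h1 : ∀ v, Continuous fun z : closedSimplex K s × I => z.1.1.1 v := fun v =>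
    (continuous_closedSimplex_coord s v).comp continuous_fst
  have h2 : Continuous fun z : closedSimplex K s × I => (z.2 : ℝ) := by fun_prop
  refine continuous_of_coord (F ∪ s.powerset.image c) (fun z p hp => ?_) fun v _ => ?_
  · rw [Finset.mem_union]
    rcases mem_support_pushVec hp with ⟨_, hp⟩ | ⟨u, hu, hne, rfl⟩
    · exact Or.inl (hF _ ((support_cutPoint_subset _ _).trans z.1.2) hp)
    · exact Or.inr (Finset.mem_image_of_mem _ (Finset.mem_powerset.2
        ((level_subset _ _).trans z.1.2)))
  · have : (fun z : closedSimplex K s × I => (H (z.1.1, z.2)).1 v) = fun z =>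
        cutMass z.1.1.1 z.2 * (φ (cutPoint z.1.1 z.2)).1 v +
        ∑ τ ∈ s.powerset, if c τ = v then (τ.card : ℝ) * duration z.1.1.1 z.2 τ else 0 := by
      ext z
      change pushVec c φ z.1.1 z.2 v = _
      rw [pushVec_eq c φ z.1.1 z.2 z.1.2]
      simp only [Finsupp.add_apply, Finsupp.smul_apply, Finsupp.finsetSum_apply, smul_eq_mul,
        Finsupp.single_apply]
    rw [this]
    refine Continuous.add (continuous_mul_of_bounded ?_ ?_ ?_) (continuous_finsetSum _ ?_)
    · simp only [fun z : closedSimplex K s × I => cutMass_eq z.1.2 z.2]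
      exact continuous_finsetSum _ fun v _ => ((h1 v).sub h2).max continuous_const
    · intro z
      rw [abs_of_nonneg (coord_nonneg _ _)]
      exact coord_le_one _ _
    -- Continuity of the normalized part is only available where its mass is nonzero; elsewhere the
    -- vanishing factor takes over.
    · exact ((continuous_coord v).comp φ.continuous).comp_continuousOn continuousOn_cutPoint
    · intro τ hτ
      split_ifs
      · exact continuous_const.mul
          (continuous_duration (fun z => z.1.2) (Finset.mem_powerset.1 hτ) h1 h2)
      · exact continuous_const

/-- Two self-maps of a flag complex with a common carrier whose values are cones are homotopic. -/
theorem homotopic_of_carrier (hC : IsConeCarrier K adj c V)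
    {φ ψ : C(GeometricRealization K, GeometricRealization K)}
    (hφ : ∀ x, ∀ p ∈ (φ x).1.support, p ∈ V x.1.support)
    (hφF : ∀ s ∈ K.faces, ∃ F : Finset X, ∀ x : GeometricRealization K, x.1.support ⊆ s →
      (φ x).1.support ⊆ F)
    (hψ : ∀ x, ∀ p ∈ (ψ x).1.support, p ∈ V x.1.support)
    (hψF : ∀ s ∈ K.faces, ∃ F : Finset X, ∀ x : GeometricRealization K, x.1.support ⊆ s →
      (ψ x).1.support ⊆ F) :
    φ.Homotopic ψ := by
  obtain ⟨H, hH⟩ := exists_homotopy_of_carrier hC hφ hφF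
  obtain ⟨H', hH'⟩ := exists_homotopy_of_carrier hC hψ hψF
  have hzero : ∀ (φ : GeometricRealization K → GeometricRealization K) x,
      pushVec c φ x 0 = (φ x).1 := by
    intro φ x
    have h0 : cutVec x.1 0 = x.1 := by
      ext v; simp [cutVec_apply, coord_nonneg]
    have h1 : cutMass x.1 0 = 1 := by
      rw [cutMass, h0]; exact sum_eq_one_of_subset x subset_rfl
    have h2 : cutPoint x 0 = x := by
      apply Subtype.ext
      rw [cutPoint_val (by rw [h1]; exact one_ne_zero), h0, h1]; simp
    rw [pushVec, h1, h2, Finset.sum_eq_zero]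
    · simp
    · intro τ _
      have : duration x.1 (0 : I) τ = 0 := by
        by_contra h
        obtain ⟨u, h1, h2, -⟩ := exists_of_duration_ne_zero h
        simp only [Icc.coe_zero] at h2
        linarith
      rw [this]; simp
  -- No coordinate exceeds 1, so at time 1 nothing is left for the map to act on and both homotopies
  -- end at the same map.
  have hone : ∀ x, pushVec c φ x 1 = pushVec c ψ x 1 := by
    intro x
    have : cutMass x.1 1 = 0 := Finset.sum_eq_zero fun v _ => by
      simp [cutVec_apply, coord_le_one x v]
    rw [pushVec, pushVec, this]; simp
  let k : C(GeometricRealization K, GeometricRealization K) :=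
    ⟨fun x => H (x, 1), H.continuous.comp (Continuous.prodMk_left 1)⟩
  have e1 : φ.Homotopic k := ⟨
    { toFun := fun z => H (z.2, z.1)
      continuous_toFun := H.continuous.comp continuous_swap
      map_zero_left := fun x => Subtype.ext ((hH x 0).trans (hzero _ x))
      map_one_left := fun x => rfl }⟩
  have e2 : ψ.Homotopic k := ⟨
    { toFun := fun z => H' (z.2, z.1)
      continuous_toFun := H'.continuous.comp continuous_swap
      map_zero_left := fun x => Subtype.ext ((hH' x 0).trans (hzero _ x))
      map_one_left := fun x => Subtype.ext ((hH' x 1).trans ((hone x).symm.trans (hH x 1).symm)) }⟩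
  exact e1.trans e2.symm

end GeometricRealization

/-! ### Treelike spaces: unique interpolation -/

/-- A metric space in which points can be interpolated between any two points and in which
geodesic triangles with sides shorter than `D` are tripods. -/
structure IsTreelike (X : Type*) [MetricSpace X] (D : ℝ) : Prop where
  interp : ∀ (x y : X) (t : I), ∃ m, dist x m = t * dist x y ∧ dist m y = (1 - t) * dist x y
  tripod : ∀ x y z m : X, dist x y < D → dist y z < D → dist x z < D →
    dist x m + dist m y = dist x y →
    dist x m + dist m z = dist x z ∨ dist y m + dist m z = dist y z

namespace IsTreelike

variable {X : Type*} [MetricSpace X] {D : ℝ}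

/-- The point at fraction `t` of the way from `x` to `y`. -/
noncomputable def between (hX : IsTreelike X D) (x y : X) (t : I) : X :=
  (hX.interp x y t).choose

lemma dist_left_between (hX : IsTreelike X D) (x y : X) (t : I) :
    dist x (hX.between x y t) = t * dist x y := (hX.interp x y t).choose_spec.1

lemma dist_between_right (hX : IsTreelike X D) (x y : X) (t : I) :
    dist (hX.between x y t) y = (1 - t) * dist x y := (hX.interp x y t).choose_spec.2

@[simp]
lemma between_zero (hX : IsTreelike X D) (x y : X) : hX.between x y 0 = x := by
  have := hX.dist_left_between x y 0
  simpa [eq_comm] using this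

@[simp]
lemma between_one (hX : IsTreelike X D) (x y : X) : hX.between x y 1 = y := by
  have := hX.dist_between_right x y 1
  simpa [eq_comm] using this

/-- Apply the tripod property with the other candidate `m'` as third vertex: `m` is then between
`m'` and one endpoint, from which both have the same distance, so they coincide. -/
lemma eq_between (hX : IsTreelike X D) {x y m : X} {t : I} (h : dist x y < D)
    (h1 : dist x m = t * dist x y) (h2 : dist m y = (1 - t) * dist x y) :
    m = hX.between x y t := by
  have h3 := hX.dist_left_between x y t
  have h4 := hX.dist_between_right x y t
  have ht := t.2
  have hd : 0 ≤ dist x y := dist_nonneg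
  set m' := hX.between x y t
  have e1 : dist x m' < D := by rw [h3]; nlinarith [ht.2]
  have e2 : dist y m' < D := by rw [dist_comm, h4]; nlinarith [ht.1]
  have e3 : dist x m + dist m y = dist x y := by rw [h1, h2]; ring
  rw [← dist_eq_zero]
  rcases hX.tripod x y m' m h e2 e1 e3 with h5 | h5
  · linarith
  · rw [dist_comm y m, dist_comm y m'] at h5; linarith

/-- By compactness it suffices to identify the cluster points. Distances pass to the limit, so a
cluster point satisfies the two equations that determine the interpolating point. -/
lemma continuousOn_between [CompactSpace X] (hX : IsTreelike X D) :
    ContinuousOn (fun q : X × X × I => hX.between q.1 q.2.1 q.2.2) {q | dist q.1 q.2.1 < D} := by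
  rintro ⟨x, y, t⟩ hq
  refine tendsto_nhds_of_unique_mapClusterPt fun m hm => ?_
  obtain ⟨U, hU, hUm⟩ := mapClusterPt_iff_ultrafilter.1 hm
  have hU' : Tendsto (fun q : X × X × I => q) U (𝓝 (x, y, t)) := hU.trans nhdsWithin_le_nhds
  have hx : Tendsto (fun q : X × X × I => q.1) U (𝓝 x) :=
    (continuous_fst.tendsto (x, y, t)).comp hU'
  have hy : Tendsto (fun q : X × X × I => q.2.1) U (𝓝 y) :=
    ((continuous_fst.comp continuous_snd).tendsto (x, y, t)).comp hU'
  have ht : Tendsto (fun q : X × X × I => (q.2.2 : ℝ)) U (𝓝 t) :=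
    ((continuous_subtype_val.comp (continuous_snd.comp continuous_snd)).tendsto (x, y, t)).comp hU'
  refine hX.eq_between hq ?_ ?_
  · refine tendsto_nhds_unique (hx.dist hUm) ?_
    simp only [dist_left_between]
    exact ht.mul (hx.dist hy)
  · refine tendsto_nhds_unique (hUm.dist hy) ?_
    simp only [dist_between_right]
    exact (tendsto_const_nhds.sub ht).mul (hx.dist hy)

end IsTreelike

/-! ### Ball hulls, their convexity and centres -/

/-- The intersection of the closed balls of radius less than `D` that contain `A`. -/
def ballHull {X : Type*} [MetricSpace X] (D : ℝ) (A : Set X) : Set X :=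
  {y | ∀ z r, r < D → (∀ p ∈ A, dist z p ≤ r) → dist z y ≤ r}

section ballHull

variable {X : Type*} [MetricSpace X] {D : ℝ} {A B : Set X}

lemma subset_ballHull : A ⊆ ballHull D A := fun p hp _ _ _ h => h p hp

lemma ballHull_mono (h : A ⊆ B) : ballHull D A ⊆ ballHull D B :=
  fun _ hy z r hr hB => hy z r hr fun p hp => hB p (h hp)

/-- Finiteness turns the strict bounds into a largest radius still below `D`, to which the
definition of the hull applies. -/
lemma dist_lt_of_mem_ballHull (hA : A.Finite) (hne : A.Nonempty) {z y : X}
    (hz : ∀ p ∈ A, dist z p < D) (hy : y ∈ ballHull D A) : dist z y < D := by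
  obtain ⟨q, hq, hmax⟩ := hA.exists_maximalFor (fun p => dist z p) A hne
  refine (hy z (dist z q) (hz q hq) fun p hp => ?_).trans_lt (hz q hq)
  rcases le_total (dist z p) (dist z q) with h | h
  · exact h
  · exact hmax hp h

/-- Balls are convex: by the tripod property a point between `y` and `p` is no farther from `z` than
one of these two. -/
lemma IsTreelike.between_mem_ballHull (hX : IsTreelike X D) (hA : A.Finite) (hne : A.Nonempty)
    (hdiam : ∀ p ∈ A, ∀ q ∈ A, dist p q < D) {y p : X} (hy : y ∈ ballHull D A) (hp : p ∈ A)
    (t : I) : hX.between y p t ∈ ballHull D A := by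
  intro z r hr hz
  have h1 : dist p y < D := dist_lt_of_mem_ballHull hA hne (hdiam p hp) hy
  have h2 := hy z r hr hz
  have h3 := hz p hp
  have hd : 0 ≤ dist y p := dist_nonneg
  have e1 := hX.dist_left_between y p t
  have e2 := hX.dist_between_right y p t
  set m := hX.between y p t
  rw [dist_comm p y] at h1
  rw [dist_comm z] at h2 h3 ⊢
  rcases hX.tripod y p z m h1 (h3.trans_lt hr) (h2.trans_lt hr) (by rw [e1, e2]; ring) with h | h
  · have := dist_nonneg (x := y) (y := m); linarith
  · have := dist_nonneg (x := p) (y := m); linarith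

/-- The midpoint of a pair `p`, `q` at maximal distance works. It lies between any `a` in `A` and
one of `p`, `q`, so its distance to `a` is at most half the diameter; the ball of that radius
contains `A`, hence the hull. -/
lemma IsTreelike.exists_center (hX : IsTreelike X D) (hA : A.Finite) (hne : A.Nonempty)
    (hdiam : ∀ p ∈ A, ∀ q ∈ A, dist p q < D) :
    ∃ c ∈ ballHull D A, ∀ y ∈ ballHull D A, dist c y ≤ D / 2 := by
  obtain ⟨⟨p, q⟩, ⟨hp, hq⟩, hmax⟩ :=
    (hA.prod hA).exists_maximalFor (fun z : X × X => dist z.1 z.2) _ (hne.prod hne)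
  have hmax' : ∀ a ∈ A, ∀ b ∈ A, dist a b ≤ dist p q := by
    intro a ha b hb
    rcases le_total (dist a b) (dist p q) with h | h
    · exact h
    · exact hmax (j := (a, b)) ⟨ha, hb⟩ h
  have hD := hdiam p hp q hq
  have hd : 0 ≤ dist p q := dist_nonneg
  let t : I := ⟨1 / 2, by norm_num, by norm_num⟩
  refine ⟨hX.between p q t, hX.between_mem_ballHull hA hne hdiam (subset_ballHull hp) hq t, ?_⟩
  intro y hy
  refine (hy _ (dist p q / 2) (by linarith) fun a ha => ?_).trans (by linarith)
  have e1 := hX.dist_left_between p q t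
  have e2 := hX.dist_between_right p q t
  have ht : (t : ℝ) = 1 / 2 := rfl
  rw [ht] at e1 e2
  rcases hX.tripod p q a _ hD (hdiam q hq a ha) (hdiam p hp a ha) (by rw [e1, e2]; ring) with h | h
  · have := hmax' p hp a ha; linarith
  · have := hmax' q hq a ha
    rw [dist_comm q] at h; linarith

end ballHull

/-! ### Maps from the realization to a treelike space -/

namespace IsTreelike

variable {X S : Type*} [MetricSpace X] {D : ℝ}

/-- Starting from `y`, move successively towards the points `a v`, by the fraction `w v`. -/
noncomputable def travel (hX : IsTreelike X D) (a : S → X) (w : S → I) (L : List S) (y : X) : X :=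
  L.foldl (fun y v => hX.between y (a v) (w v)) y

/-- A move by the full fraction 1 forgets the past. -/
lemma travel_indep (hX : IsTreelike X D) (a : S → X) (w : S → I) (L : List S)
    (h : ∃ v ∈ L, w v = 1) (y y' : X) : hX.travel a w L y = hX.travel a w L y' := by
  induction L generalizing y y' with
  | nil => simp at h
  | cons v L ih =>
    change hX.travel a w L _ = hX.travel a w L _
    by_cases hv : w v = 1
    · simp [hv]
    · apply ih
      obtain ⟨u, hu, hu1⟩ := h
      rcases List.mem_cons.1 hu with rfl | hu
      · exact absurd hu1 hv
      · exact ⟨u, hu, hu1⟩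

lemma travel_filter [DecidableEq S] (hX : IsTreelike X D) (a : S → X) (w : S → I) (L : List S) (τ : Finset S)
    (h : ∀ v ∉ τ, w v = 0) (y : X) :
    hX.travel a w (L.filter (· ∈ τ)) y = hX.travel a w L y := by
  induction L generalizing y with
  | nil => rfl
  | cons v L ih =>
    by_cases hv : v ∈ τ
    · rw [List.filter_cons_of_pos (by simpa using hv)]
      exact ih _
    · rw [List.filter_cons_of_neg (by simpa using hv)]
      refine (ih y).trans ?_
      change _ = hX.travel a w L (hX.between y (a v) (w v))
      rw [h v hv, between_zero]

lemma travel_mem_ballHull (hX : IsTreelike X D) {a : S → X} {s : Finset S}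
    (hdiam : ∀ p ∈ s, ∀ q ∈ s, dist (a p) (a q) < D) (w : S → I) {L : List S}
    (hL : ∀ v ∈ L, v ∈ s) {y : X} (hy : y ∈ ballHull D (a '' s)) :
    hX.travel a w L y ∈ ballHull D (a '' s) := by
  induction L generalizing y with
  | nil => exact hy
  | cons v L ih =>
    have hv := hL v (by simp)
    refine ih (fun u hu => hL u (by simp [hu])) ?_
    refine hX.between_mem_ballHull (s.finite_toSet.image a) ⟨_, mem_image_of_mem a hv⟩ ?_ hy
      (mem_image_of_mem a hv) _
    rintro _ ⟨p, hp, rfl⟩ _ ⟨q, hq, rfl⟩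
    exact hdiam p hp q hq

lemma continuous_travel [CompactSpace X] (hX : IsTreelike X D) {a : S → X} {s : Finset S}
    (hdiam : ∀ p ∈ s, ∀ q ∈ s, dist (a p) (a q) < D) {Z : Type*} [TopologicalSpace Z]
    {w : Z → S → I} (hw : ∀ v ∈ s, Continuous fun z => w z v) {L : List S}
    (hL : ∀ v ∈ L, v ∈ s) {y : Z → X} (hy : ∀ z, y z ∈ ballHull D (a '' s))
    (hyc : Continuous y) : Continuous fun z => hX.travel a (w z) L (y z) := by
  induction L generalizing y with
  | nil => exact hyc
  | cons v L ih =>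
    have hv := hL v (by simp)
    have hdiam' : ∀ p ∈ a '' s, ∀ q ∈ a '' s, dist p q < D := by
      rintro _ ⟨p, hp, rfl⟩ _ ⟨q, hq, rfl⟩
      exact hdiam p hp q hq
    refine ih (fun u hu => hL u (by simp [hu])) (fun z => ?_) ?_
    · exact hX.between_mem_ballHull (s.finite_toSet.image a) ⟨_, mem_image_of_mem a hv⟩ hdiam'
        (hy z) (mem_image_of_mem a hv) _
    · refine hX.continuousOn_between.comp_continuous
        (hyc.prodMk (continuous_const.prodMk (hw v hv))) fun z => ?_
      change dist (y z) (a v) < D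
      rw [dist_comm]
      exact dist_lt_of_mem_ballHull (s.finite_toSet.image a) ⟨_, mem_image_of_mem a hv⟩
        (fun p hp => hdiam' _ (mem_image_of_mem a hv) p hp) (hy z)

end IsTreelike

namespace GeometricRealization

variable {S : Type*} {K : PreAbstractSimplicialComplex S}

lemma support_nonempty (x : GeometricRealization K) : x.1.support.Nonempty :=
  (K.isRelLowerSet_faces x.support_mem).1

/-- The largest barycentric coordinate. -/
noncomputable def maxCoord (x : GeometricRealization K) : ℝ :=
  x.1.support.sup' x.support_nonempty x.1

lemma maxCoord_eq (x : GeometricRealization K) {s : Finset S} (hs : x.1.support ⊆ s) :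
    x.maxCoord = s.sup' (x.support_nonempty.mono hs) x.1 := by
  refine le_antisymm (Finset.sup'_mono _ hs _) (Finset.sup'_le _ _ fun v _ => ?_)
  by_cases hv : v ∈ x.1.support
  · exact Finset.le_sup' (fun v => x.1 v) hv
  · obtain ⟨u, hu⟩ := x.support_nonempty
    rw [Finsupp.notMem_support_iff.1 hv]
    exact (x.coord_nonneg u).trans (Finset.le_sup' (fun v => x.1 v) hu)

lemma maxCoord_pos (x : GeometricRealization K) : 0 < x.maxCoord := by
  obtain ⟨u, hu⟩ := x.support_nonempty
  exact ((x.coord_nonneg u).lt_of_ne (Finsupp.mem_support_iff.1 hu).symm).trans_le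
    (Finset.le_sup' (fun v => x.1 v) hu)

/-- The ratio of a barycentric coordinate to the largest one. -/
noncomputable def ratio (x : GeometricRealization K) (v : S) : I :=
  projIcc 0 1 zero_le_one (x.1 v / x.maxCoord)

lemma ratio_eq_zero {x : GeometricRealization K} {v : S} (h : v ∉ x.1.support) :
    x.ratio v = 0 := by
  rw [ratio, Finsupp.notMem_support_iff.1 h, zero_div]
  exact projIcc_left (zero_le_one' ℝ)

lemma exists_ratio_eq_one (x : GeometricRealization K) : ∃ v ∈ x.1.support, x.ratio v = 1 := by
  obtain ⟨v, hv, h⟩ := Finset.exists_mem_eq_sup' x.support_nonempty x.1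
  refine ⟨v, hv, ?_⟩
  have hm : x.maxCoord = x.1 v := h
  rw [ratio, ← hm, div_self x.maxCoord_pos.ne']
  exact projIcc_right (zero_le_one' ℝ)

lemma continuous_ratio (s : Finset S) (v : S) :
    @Continuous _ _ (coordTopology s) _ fun x : closedSimplex K s => x.1.ratio v := by
  let _ := coordTopology (K := K) s
  have h : Continuous fun x : closedSimplex K s => x.1.maxCoord := by
    rcases s.eq_empty_or_nonempty with rfl | hs
    · refine continuous_of_const fun x => ?_
      exact absurd (x.1.support_nonempty.mono x.2) Finset.not_nonempty_empty
    · have : (fun x : closedSimplex K s => x.1.maxCoord) = fun x => s.sup' hs fun v => x.1.1 v :=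
        funext fun x => maxCoord_eq x.1 x.2
      rw [this]
      exact Continuous.finset_sup'_apply hs fun v _ => continuous_closedSimplex_coord s v
  exact continuous_projIcc.comp
    ((continuous_closedSimplex_coord s v).div h fun x => x.1.maxCoord_pos.ne')

section toTree

variable [LinearOrder S] {X : Type*} [MetricSpace X] {D : ℝ}

/-- The map from the realization that sends the vertices to given points of a treelike space. -/
noncomputable def toTree (hX : IsTreelike X D) (a : S → X) (x : GeometricRealization K) : X :=
  hX.travel a x.ratio (x.1.support.sort) (a x.support_nonempty.choose)

/-- On a whole closed simplex the map is given by one formula: vertices outside the support have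
ratio 0 and cause no move, and a vertex of ratio 1 erases the choice of starting point. Continuity
follows from this. -/
lemma toTree_eq (hX : IsTreelike X D) (a : S → X) (x : GeometricRealization K) {s : Finset S}
    (hs : x.1.support ⊆ s) (y : X) : x.toTree hX a = hX.travel a x.ratio s.sort y := by
  have h1 : x.1.support.sort = s.sort.filter (· ∈ x.1.support) := by
    refine List.Perm.eq_of_pairwise' (r := (· ≤ ·)) (Finset.pairwise_sort _ _)
      ((Finset.pairwise_sort _ _).filter _) ?_
    rw [List.perm_ext_iff_of_nodup (Finset.sort_nodup _ _) ((Finset.sort_nodup _ _).filter _)]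
    intro v
    simp only [Finset.mem_sort, List.mem_filter, decide_eq_true_eq]
    exact ⟨fun h => ⟨hs h, h⟩, fun h => h.2⟩
  rw [toTree, h1]
  refine (hX.travel_filter a x.ratio s.sort x.1.support (fun v hv => ratio_eq_zero hv) _).trans ?_
  obtain ⟨v, hv, h⟩ := x.exists_ratio_eq_one
  exact hX.travel_indep _ _ _ ⟨v, (Finset.mem_sort _).2 (hs hv), h⟩ _ _

lemma toTree_mem_ballHull (hX : IsTreelike X D) {a : S → X}
    (ha : ∀ s ∈ K.faces, ∀ p ∈ s, ∀ q ∈ s, dist (a p) (a q) < D) (x : GeometricRealization K) :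
    x.toTree hX a ∈ ballHull D (a '' x.1.support) :=
  hX.travel_mem_ballHull (ha _ x.support_mem) _ (fun _ hv => (Finset.mem_sort _).1 hv)
    (subset_ballHull (mem_image_of_mem a x.support_nonempty.choose_spec))

lemma continuous_toTree [CompactSpace X] (hX : IsTreelike X D) {a : S → X}
    (ha : ∀ s ∈ K.faces, ∀ p ∈ s, ∀ q ∈ s, dist (a p) (a q) < D) :
    Continuous fun x : GeometricRealization K => x.toTree hX a := by
  rw [continuous_iff]
  intro s hs
  let _ := coordTopology (K := K) s
  obtain ⟨v, hv⟩ := (K.isRelLowerSet_faces hs).1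
  simp only [fun x : closedSimplex K s => toTree_eq hX a x.1 x.2 (a v)]
  exact hX.continuous_travel (ha s hs) (fun v _ => continuous_ratio s v)
    (fun _ hv => (Finset.mem_sort _).1 hv)
    (fun _ => subset_ballHull (mem_image_of_mem a hv)) continuous_const

end toTree

/-! ### Partition of unity and the abstract homotopy equivalence -/

/-- A map from a compact metric space to a realization by a partition of unity subordinate to a
finite cover by balls. -/
lemma exists_map_of_compact {X : Type*} [MetricSpace X] [CompactSpace X] (s : X → S) {η : ℝ}
    (hη : 0 < η)
    (hs : ∀ x : X, ∀ t : Finset S, t.Nonempty → (∀ p ∈ t, ∃ y, dist x y < η ∧ p = s y) →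
      t ∈ K.faces) :
    ∃ (g : C(X, GeometricRealization K)) (F : Finset S), (∀ x, (g x).1.support ⊆ F) ∧
      ∀ x, ∀ p ∈ (g x).1.support, ∃ y, dist x y < η ∧ p = s y := by
  classical
  obtain ⟨T, -, hT, hcov⟩ := finite_cover_balls_of_compact (isCompact_univ (X := X)) hη
  let T' : Finset X := hT.toFinset
  let μ : X → X → ℝ := fun y x => max (η - dist x y) 0
  have hμ0 : ∀ y x, 0 ≤ μ y x := fun _ _ => le_max_right _ _
  have hμc : ∀ y, Continuous (μ y) := fun y => by fun_prop
  have hμ : ∀ y x, μ y x ≠ 0 → dist x y < η := by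
    intro y x h
    by_contra h'
    exact h (max_eq_right (by linarith))
  let M : X → ℝ := fun x => ∑ y ∈ T', μ y x
  have hMc : Continuous M := continuous_finsetSum _ fun y _ => hμc y
  have hM : ∀ x, 0 < M x := by
    intro x
    obtain ⟨y, hy, hxy⟩ := mem_iUnion₂.1 (hcov (mem_univ x))
    rw [Metric.mem_ball] at hxy
    refine Finset.sum_pos' (fun y _ => hμ0 y x) ⟨y, hT.mem_toFinset.2 hy, ?_⟩
    exact lt_max_of_lt_left (by linarith)
  let G : X → S →₀ ℝ := fun x => ∑ y ∈ T', Finsupp.single (s y) (μ y x / M x)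
  have hGapp : ∀ x v, G x v = ∑ y ∈ T', if s y = v then μ y x / M x else 0 := by
    intro x v
    simp only [G, Finsupp.finsetSum_apply, Finsupp.single_apply]
  have hG0 : ∀ x v, 0 ≤ G x v := by
    intro x v
    rw [hGapp]
    refine Finset.sum_nonneg fun y _ => ?_
    split_ifs
    · exact div_nonneg (hμ0 _ _) (hM x).le
    · exact le_rfl
  have hGsum : ∀ x, ((G x).sum fun _ r => r) = 1 := by
    intro x
    have : ((G x).sum fun _ r => r) = Finsupp.linearCombination ℝ (fun _ => (1 : ℝ)) (G x) := by
      simp [Finsupp.linearCombination_apply]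
    rw [this]
    simp only [G, map_sum, Finsupp.linearCombination_single, smul_eq_mul, mul_one]
    rw [← Finset.sum_div]
    exact div_self (hM x).ne'
  have hGsupp : ∀ x, ∀ p ∈ (G x).support, ∃ y ∈ T', dist x y < η ∧ p = s y := by
    intro x p hp
    by_contra! H
    refine Finsupp.mem_support_iff.1 hp ?_
    rw [hGapp]
    refine Finset.sum_eq_zero fun y hy => ?_
    split_ifs with h
    · by_contra h'
      exact H y hy (hμ y x (fun h0 => h' (by rw [h0, zero_div]))) h.symm
    · rfl
  have hGne : ∀ x, (G x).support.Nonempty := by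
    intro x
    rw [Finsupp.support_nonempty_iff]
    intro h
    have := hGsum x
    simp [h] at this
  have hGface : ∀ x, (G x).support ∈ K.faces := by
    intro x
    refine hs x _ (hGne x) fun p hp => ?_
    obtain ⟨y, -, h⟩ := hGsupp x p hp
    exact ⟨y, h⟩
  let g : X → GeometricRealization K := fun x => ⟨G x, hGface x, hG0 x, hGsum x⟩
  have hF : ∀ x, (g x).1.support ⊆ T'.image s := by
    intro x p hp
    obtain ⟨y, hy, -, rfl⟩ := hGsupp x p hp
    exact Finset.mem_image_of_mem s hy
  refine ⟨⟨g, continuous_of_coord _ hF fun v _ => ?_⟩, _, hF, ?_⟩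
  · change Continuous fun x => G x v
    simp only [hGapp]
    refine continuous_finsetSum _ fun y _ => ?_
    split_ifs
    · exact (hμc y).div hMc fun x => (hM x).ne'
    · exact continuous_const
  · intro x p hp
    obtain ⟨y, -, h⟩ := hGsupp x p hp
    exact ⟨y, h⟩

/-- A flag complex on a set in suitable correspondence with a compact treelike space is homotopy
equivalent to that space. -/
theorem nonempty_homotopyEquiv_of_isTreelike {X : Type*} [MetricSpace X] [CompactSpace X]
    [Nonempty X] {D r : ℝ} (hD : 0 < D) (hDr : D / 2 < r) (hX : IsTreelike X D)
    {adj : S → S → Prop}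
    (flag : ∀ s : Finset S, s ∈ K.faces ↔ s.Nonempty ∧ ∀ p ∈ s, ∀ q ∈ s, adj p q)
    (symm : ∀ p q, adj p q → adj q p) {N : S → X → Prop}
    (hN1 : ∀ p, ∃ x, N p x) (hN2 : ∀ x, ∃ p, N p x)
    (hlt : ∀ p q x y, adj p q → N p x → N q y → dist x y < D)
    (hadj : ∀ p q x y, N p x → N q y → dist x y ≤ r → adj p q) :
    Nonempty (GeometricRealization K ≃ₕ X) := by
  classical
  -- An arbitrary linear order fixes the sequence in which the vertices of a simplex are visited.
  let _ : LinearOrder S := linearOrderOfSTO WellOrderingRel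
  choose a ha using hN1
  choose s hs using hN2
  have hdiam : ∀ ρ ∈ K.faces, ∀ p ∈ ρ, ∀ q ∈ ρ, dist (a p) (a q) < D := fun ρ hρ p hp q hq =>
    hlt p q _ _ (((flag _).1 hρ).2 p hp q hq) (ha p) (ha q)
  have hcenter : ∀ ρ ∈ K.faces, ∃ c ∈ ballHull D (a '' ρ),
      ∀ y ∈ ballHull D (a '' ρ), dist c y ≤ D / 2 := by
    intro ρ hρ
    refine hX.exists_center (ρ.finite_toSet.image a) ((Finset.coe_nonempty.2 (K.isRelLowerSet_faces hρ).1).image a) ?_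
    rintro _ ⟨p, hp, rfl⟩ _ ⟨q, hq, rfl⟩
    exact hdiam ρ hρ p hp q hq
  choose! c hc hcd using hcenter
  have hhull : ∀ {τ ρ : Finset S}, τ ⊆ ρ → ballHull D (a '' τ) ⊆ ballHull D (a '' ρ) :=
    fun h => ballHull_mono (image_mono h)
  -- The first bound gives D/2 + η ≤ r, used for adjacency to the apex. The second gives 2η ≤ r, so
  -- points within η of a common point have adjacent samples.
  let η : ℝ := min (r - D / 2) (r / 2)
  have hη : 0 < η := lt_min (by linarith) (by linarith)
  have hη1 : η ≤ r - D / 2 := min_le_left _ _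
  have hη2 : η ≤ r / 2 := min_le_right _ _
  obtain ⟨g, F, hgF, hg⟩ := exists_map_of_compact (K := K) s hη (by
    intro x t ht hxt
    rw [flag]
    refine ⟨ht, fun p hp q hq => ?_⟩
    obtain ⟨y, hy, rfl⟩ := hxt p hp
    obtain ⟨z, hz, rfl⟩ := hxt q hq
    refine hadj _ _ _ _ (hs y) (hs z) ((dist_triangle_left y z x).trans ?_)
    linarith)
  let f : C(GeometricRealization K, X) := ⟨fun x => x.toTree hX a, continuous_toTree hX hdiam⟩
  have hf : ∀ x, f x ∈ ballHull D (a '' x.1.support) := toTree_mem_ballHull hX hdiam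
  -- Every vertex used by `g x` is adjacent to `s x`, so its image under `a` lies within `D` of `x`;
  -- the hull containing `f (g x)` then does too.
  have hfg : ∀ x, dist (f (g x)) x < D := by
    intro x
    rw [dist_comm]
    refine dist_lt_of_mem_ballHull ((g x).1.support.finite_toSet.image a)
      ((Finset.coe_nonempty.2 (g x).support_nonempty).image a) ?_ (hf (g x))
    rintro _ ⟨p, hp, rfl⟩
    obtain ⟨y, hxy, rfl⟩ := hg x p hp
    exact hlt _ _ _ _ (hadj _ _ _ _ (hs x) (hs y) (by linarith)) (hs x) (ha _)
  -- The carrier of a simplex consists of the samples of points near its hull. It contains the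
  -- vertices of the simplex as well as those used by `g` at points of the hull, so it serves both
  -- the identity and `g ∘ f`.
  let V : Finset S → Set S := fun ρ => {p | ∃ y, ∃ y' ∈ ballHull D (a '' ρ), N p y ∧ dist y' y < η}
  have hC : IsConeCarrier K adj (fun ρ => s (c ρ)) V := by
    refine ⟨flag, symm, ?_, ?_⟩
    · rintro τ hτ ρ hρ hτρ p ⟨y, y', hy', hpy, hyy'⟩
      refine hadj _ _ _ _ hpy (hs _) ?_
      have := hcd ρ hρ y' (hhull hτρ hy')
      have := dist_triangle y y' (c ρ)
      rw [dist_comm y y', dist_comm y' (c ρ)] at this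
      linarith
    · intro τ hτ ρ hρ hτρ
      refine hadj _ _ _ _ (hs _) (hs _) ?_
      have := hcd ρ hρ _ (hhull hτρ (hc τ hτ))
      rw [dist_comm] at this
      linarith
  refine ⟨⟨f, g, ?_, ?_⟩⟩
  · refine homotopic_of_carrier hC ?_ (fun _ _ => ⟨F, fun x _ => hgF _⟩) ?_
      (fun t _ => ⟨t, fun x h => h⟩)
    · intro x p hp
      obtain ⟨y, hxy, rfl⟩ := hg (f x) p hp
      exact ⟨y, f x, hf x, hs y, hxy⟩
    · intro x p hp
      exact ⟨a p, a p, subset_ballHull (mem_image_of_mem a hp), ha p, by simpa using hη⟩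
  · refine ⟨{ toFun := fun z => hX.between (f (g z.2)) z.2 z.1
              continuous_toFun := ?_
              map_zero_left := fun x => by simp
              map_one_left := fun x => by simp }⟩
    refine hX.continuousOn_between.comp_continuous
      (((f.continuous.comp g.continuous).comp continuous_snd).prodMk
        (continuous_snd.prodMk continuous_fst)) fun z => ?_
    exact hfg z.2

end GeometricRealization

/-! ### Lengths and simplicity of concatenated paths -/

section curveLength

variable {E : Type*} [MetricSpace E]

lemma curveLength_symm {a b : E} (γ : Path a b) : curveLength γ.symm ≤ curveLength γ :=
  eVariationOn.comp_le_of_antitoneOn γ unitInterval.symm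
    (fun _ _ _ _ h => unitInterval.symm_le_symm.2 h) (mapsTo_univ _ _)

lemma curveLength_trans {a b c : E} (γ : Path a b) (γ' : Path b c) :
    curveLength (γ.trans γ') ≤ curveLength γ + curveLength γ' := by
  let h : I := ⟨1 / 2, by norm_num, by norm_num⟩
  have hu : (univ : Set I) = Iic h ∪ Ici h := (Iic_union_Ici).symm
  rw [curveLength, hu, eVariationOn.union _ (isGreatest_Iic (a := h)) isLeast_Ici]
  refine add_le_add ?_ ?_
  · have : EqOn (γ.trans γ') (γ ∘ fun t : I => projIcc 0 1 zero_le_one (2 * (t : ℝ))) (Iic h) := by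
      intro t ht
      have ht' : (t : ℝ) ≤ 1 / 2 := ht
      change (γ.trans γ') t = γ.extend (2 * t)
      rw [← Path.extend_extends', Path.extend_trans_of_le_half _ _ ht']
    rw [eVariationOn.congr this]
    refine eVariationOn.comp_le_of_monotoneOn _ _ (fun s _ t _ hst => ?_) (mapsTo_univ _ _)
    exact monotone_projIcc _ (by have : (s : ℝ) ≤ t := hst; linarith)
  · have : EqOn (γ.trans γ') (γ' ∘ fun t : I => projIcc 0 1 zero_le_one (2 * (t : ℝ) - 1))
        (Ici h) := by
      intro t ht
      have ht' : 1 / 2 ≤ (t : ℝ) := ht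
      change (γ.trans γ') t = γ'.extend (2 * t - 1)
      rw [← Path.extend_extends', Path.extend_trans_of_half_le _ _ ht']
    rw [eVariationOn.congr this]
    refine eVariationOn.comp_le_of_monotoneOn _ _ (fun s _ t _ hst => ?_) (mapsTo_univ _ _)
    exact monotone_projIcc _ (by have : (s : ℝ) ≤ t := hst; linarith)

/-- The junction is assigned to the first path, so the parameter on the second is strictly positive;
this removes the double point in the injectivity arguments. -/
lemma Path.trans_eq_or {a b c : E} (γ : Path a b) (γ' : Path b c) (t : I) :
    (∃ u : I, (u : ℝ) = 2 * t ∧ γ.trans γ' t = γ u) ∨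
      ∃ u : I, 0 < (u : ℝ) ∧ (u : ℝ) = 2 * t - 1 ∧ γ.trans γ' t = γ' u := by
  rw [Path.trans_apply]
  split_ifs with h
  · exact Or.inl ⟨_, rfl, rfl⟩
  · exact Or.inr ⟨_, by simp only [not_le] at h; change (0 : ℝ) < 2 * t - 1; linarith, rfl, rfl⟩

lemma Path.injective_trans {a b c : E} {γ : Path a b} {γ' : Path b c}
    (hγ : Function.Injective γ) (hγ' : Function.Injective γ')
    (h : range γ ∩ range γ' ⊆ {b}) : Function.Injective (γ.trans γ') := by
  have key : ∀ u v : I, γ u = γ' v → v = 0 := by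
    intro u v huv
    refine hγ' ?_
    rw [γ'.source, ← huv]
    exact h ⟨mem_range_self u, v, huv.symm⟩
  intro s t hst
  apply Subtype.ext
  rcases γ.trans_eq_or γ' s with ⟨u, hu, hsu⟩ | ⟨u, hu0, hu, hsu⟩ <;>
  rcases γ.trans_eq_or γ' t with ⟨v, hv, htv⟩ | ⟨v, hv0, hv, htv⟩ <;> rw [hsu, htv] at hst
  · have := hγ hst; subst this; linarith
  · rw [key _ _ hst] at hv0; exact absurd hv0 (lt_irrefl _)
  · rw [key _ _ hst.symm] at hu0; exact absurd hu0 (lt_irrefl _)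
  · have := hγ' hst; subst this; linarith

lemma Path.injOn_trans_loop {a b : E} {γ : Path a b} {γ' : Path b a}
    (hγ : Function.Injective γ) (hγ' : Function.Injective γ')
    (h : range γ ∩ range γ' ⊆ {a, b}) : InjOn (γ.trans γ') (Ico 0 1) := by
  have key : ∀ u v : I, γ u = γ' v → v = 0 ∨ v = 1 := by
    intro u v huv
    rcases h ⟨mem_range_self u, v, huv.symm⟩ with h1 | h1
    · right
      apply hγ'
      rw [γ'.target, ← huv, h1]
    · left
      apply hγ'
      rw [γ'.source, ← huv, h1]
  have key' : ∀ u v t : I, t < 1 → 0 < (v : ℝ) → (v : ℝ) = 2 * t - 1 → γ u ≠ γ' v := by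
    intro u v t ht hv hvt huv
    have ht' : (t : ℝ) < 1 := ht
    rcases key u v huv with rfl | rfl
    · exact lt_irrefl _ hv
    · simp only [Icc.coe_one] at hvt; linarith
  intro s hs t ht hst
  apply Subtype.ext
  rcases γ.trans_eq_or γ' s with ⟨u, hu, hsu⟩ | ⟨u, hu0, hu, hsu⟩ <;>
  rcases γ.trans_eq_or γ' t with ⟨v, hv, htv⟩ | ⟨v, hv0, hv, htv⟩ <;> rw [hsu, htv] at hst
  · have := hγ hst; subst this; linarith
  · exact absurd hst (key' _ _ _ ht.2 hv0 hv)
  · exact absurd hst.symm (key' _ _ _ hs.2 hu0 hu)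
  · have := hγ' hst; subst this; linarith

end curveLength

/-! ### Short geodesic triangles are tripods -/

section tripod

variable {X : Type*} [MetricSpace X]

/-- `α` is a unit speed geodesic on `[0, L]`. -/
def IsGeodesic (α : ℝ → X) (L : ℝ) : Prop :=
  ∀ s ∈ Icc 0 L, ∀ t ∈ Icc 0 L, dist (α s) (α t) = |s - t|

/-- `p` and `q` are joined by a simple arc in `R` of length at most `L`. -/
def HasArc (p q : X) (R : Set X) (L : ℝ) : Prop :=
  ∃ γ : Path p q, Function.Injective γ ∧ range γ ⊆ R ∧ curveLength γ ≤ ENNReal.ofReal L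

lemma HasArc.symm {p q : X} {R : Set X} {L : ℝ} (h : HasArc p q R L) : HasArc q p R L := by
  obtain ⟨γ, h1, h2, h3⟩ := h
  refine ⟨γ.symm, h1.comp unitInterval.symm_bijective.injective, ?_, (curveLength_symm γ).trans h3⟩
  rwa [Path.symm_range]

lemma HasArc.mono {p q : X} {R R' : Set X} {L L' : ℝ} (h : HasArc p q R L) (hR : R ⊆ R')
    (hL : L ≤ L') : HasArc p q R' L' := by
  obtain ⟨γ, h1, h2, h3⟩ := h
  exact ⟨γ, h1, h2.trans hR, h3.trans (ENNReal.ofReal_le_ofReal hL)⟩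

lemma HasArc.trans {p q r : X} {R R' : Set X} {L L' : ℝ} (h : HasArc p q R L)
    (h' : HasArc q r R' L') (hR : R ∩ R' ⊆ {q}) (hL : 0 ≤ L) (hL' : 0 ≤ L') :
    HasArc p r (R ∪ R') (L + L') := by
  obtain ⟨γ, h1, h2, h3⟩ := h
  obtain ⟨γ', h1', h2', h3'⟩ := h'
  refine ⟨γ.trans γ', Path.injective_trans h1 h1' ((inter_subset_inter h2 h2').trans hR), ?_, ?_⟩
  · rw [Path.trans_range]
    exact union_subset_union h2 h2'
  · rw [ENNReal.ofReal_add hL hL']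
    exact (curveLength_trans γ γ').trans (add_le_add h3 h3')

lemma HasArc.exists_loop {p q : X} {R R' : Set X} {L L' : ℝ} (h : HasArc p q R L)
    (h' : HasArc q p R' L') (hR : R ∩ R' ⊆ {p, q}) (hL : 0 ≤ L) (hL' : 0 ≤ L') :
    ∃ γ : Path p p, InjOn γ (Ico 0 1) ∧ curveLength γ ≤ ENNReal.ofReal (L + L') := by
  obtain ⟨γ, h1, h2, h3⟩ := h
  obtain ⟨γ', h1', h2', h3'⟩ := h'
  refine ⟨γ.trans γ', Path.injOn_trans_loop h1 h1' ((inter_subset_inter h2 h2').trans hR), ?_⟩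
  rw [ENNReal.ofReal_add hL hL']
  exact (curveLength_trans γ γ').trans (add_le_add h3 h3')

lemma IsGeodesic.lipschitzOnWith {α : ℝ → X} {L : ℝ} (h : IsGeodesic α L) :
    LipschitzOnWith 1 α (Icc 0 L) :=
  LipschitzOnWith.of_dist_le_mul fun s hs t ht => by
    rw [h s hs t ht, NNReal.coe_one, one_mul, Real.dist_eq]

lemma IsGeodesic.hasArc {α : ℝ → X} {L : ℝ} (h : IsGeodesic α L) {a b : ℝ} (ha : 0 ≤ a)
    (hab : a < b) (hb : b ≤ L) : HasArc (α a) (α b) (α '' Icc a b) (b - a) := by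
  let φ : I → ℝ := fun u => a + (b - a) * u
  have hφm : Monotone φ := fun u v huv => by
    have : (u : ℝ) ≤ v := huv
    simp only [φ]; nlinarith
  have hφab : ∀ u, φ u ∈ Icc a b := fun u => by
    have h0 := u.2.1; have h1 := u.2.2
    constructor <;> simp only [φ] <;> nlinarith
  have hφ : ∀ u, φ u ∈ Icc 0 L := fun u => ⟨ha.trans (hφab u).1, (hφab u).2.trans hb⟩
  refine ⟨{ toFun := α ∘ φ
            continuous_toFun := h.lipschitzOnWith.continuousOn.comp_continuous
              (by simp only [φ]; fun_prop) hφ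
            source' := by simp [φ]
            target' := by simp [φ] }, ?_, ?_, ?_⟩
  · intro u v huv
    have h1 : dist (α (φ u)) (α (φ v)) = 0 := by rw [dist_eq_zero]; exact huv
    rw [h _ (hφ u) _ (hφ v), abs_eq_zero] at h1
    have h2 : (b - a) * ((u : ℝ) - v) = 0 := by simp only [φ] at h1; linarith
    rcases mul_eq_zero.1 h2 with h3 | h3
    · linarith
    · exact Subtype.ext (by linarith)
  · rintro _ ⟨u, rfl⟩
    exact mem_image_of_mem α (hφab u)
  · refine (h.lipschitzOnWith.comp_eVariationOn_le (f := α) (g := φ) (s := univ)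
      (fun u _ => hφ u)).trans ?_
    have h1 := (hφm.monotoneOn univ).eVariationOn_eq (mem_univ (0 : I)) (mem_univ (1 : I))
    have h2 : (univ ∩ Icc (0 : I) 1) = univ := by
      rw [univ_inter]; exact eq_univ_of_forall fun u => u.2
    rw [h2] at h1
    simpa [φ] using h1.le

lemma IsGeodesic.hasArc' {α : ℝ → X} {L : ℝ} (h : IsGeodesic α L) {a b : ℝ} (ha : a ∈ Icc 0 L)
    (hb : b ∈ Icc 0 L) (hab : a ≠ b) : HasArc (α a) (α b) (α '' Icc 0 L) L := by
  rcases hab.lt_or_gt with h1 | h1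
  · exact (h.hasArc ha.1 h1 hb.2).mono (image_mono (Icc_subset_Icc ha.1 hb.2))
      (by linarith [ha.1, hb.2])
  · exact (h.hasArc hb.1 h1 ha.2).symm.mono (image_mono (Icc_subset_Icc hb.1 ha.2))
      (by linarith [hb.1, ha.2])

/-- Walk back along `β` to the last parameter `u` at which the geodesics agree, then out along `γ`.
Both start at the same point, so they can only meet at equal parameters; hence the two pieces meet
only at the branch point. -/
lemma IsGeodesic.hasArc_of_notMem {β γ : ℝ → X} {L M : ℝ} (hβ : IsGeodesic β L)
    (hγ : IsGeodesic γ M) (h0 : β 0 = γ 0) {b c : ℝ} (hb : b ∈ Icc 0 L) (hc : c ∈ Icc 0 M)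
    (hb' : β b ∉ γ '' Icc 0 M) (hc' : γ c ∉ β '' Icc 0 L) :
    HasArc (β b) (γ c) (β '' Icc 0 L ∪ γ '' Icc 0 M) (L + M) := by
  let k := min b c
  have hk : IsCompact {u ∈ Icc 0 k | dist (β u) (γ u) = 0} := by
    have c1 : ContinuousOn β (Icc 0 k) := hβ.lipschitzOnWith.continuousOn.mono
      (Icc_subset_Icc_right ((min_le_left _ _).trans hb.2))
    have c2 : ContinuousOn γ (Icc 0 k) := hγ.lipschitzOnWith.continuousOn.mono
      (Icc_subset_Icc_right ((min_le_right _ _).trans hc.2))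
    have hcont : ContinuousOn (fun u => dist (β u) (γ u)) (Icc 0 k) :=
      continuous_dist.comp_continuousOn (c1.prodMk c2)
    have := hcont.preimage_isClosed_of_isClosed isClosed_Icc (isClosed_singleton (x := (0 : ℝ)))
    exact isCompact_Icc.of_isClosed_subset this fun _ h => h.1
  obtain ⟨u, ⟨huk, hu⟩, hmax⟩ := hk.exists_isGreatest
    ⟨0, ⟨le_rfl, le_min hb.1 hc.1⟩, by rw [h0, dist_self]⟩
  rw [dist_eq_zero] at hu
  have hub : u < b := by
    refine (huk.2.trans (min_le_left _ _)).lt_of_ne ?_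
    rintro rfl
    exact hb' ⟨u, ⟨huk.1, huk.2.trans ((min_le_right _ _).trans hc.2)⟩, hu.symm⟩
  have huc : u < c := by
    refine (huk.2.trans (min_le_right _ _)).lt_of_ne ?_
    rintro rfl
    exact hc' ⟨u, ⟨huk.1, huk.2.trans ((min_le_left _ _).trans hb.2)⟩, hu⟩
  have a1 := (hβ.hasArc huk.1 hub hb.2).symm
  have a2 := hγ.hasArc huk.1 huc hc.2
  rw [← hu] at a2
  refine (a1.trans a2 ?_ (by linarith) (by linarith)).mono ?_ (by linarith [huk.1, hb.2, hc.2])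
  · rintro _ ⟨⟨s, hs, rfl⟩, t, ht, hst⟩
    have hs' : s ∈ Icc 0 L := ⟨huk.1.trans hs.1, hs.2.trans hb.2⟩
    have ht' : t ∈ Icc 0 M := ⟨huk.1.trans ht.1, ht.2.trans hc.2⟩
    have e1 := hβ 0 ⟨le_rfl, hb.1.trans hb.2⟩ s hs'
    have e2 := hγ 0 ⟨le_rfl, hc.1.trans hc.2⟩ t ht'
    rw [zero_sub, abs_neg, abs_of_nonneg hs'.1] at e1
    rw [zero_sub, abs_neg, abs_of_nonneg ht'.1, hst, ← h0, e1] at e2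
    subst e2
    have : s ≤ u := hmax ⟨⟨hs'.1, le_min hs.2 ht.2⟩, by rw [hst, dist_self]⟩
    rw [le_antisymm this hs.1]
    rfl
  · exact union_subset_union (image_mono (Icc_subset_Icc huk.1 hb.2))
      (image_mono (Icc_subset_Icc huk.1 hc.2))

lemma IsGeodesic.hasArc_union {β γ : ℝ → X} {L M : ℝ} (hβ : IsGeodesic β L)
    (hγ : IsGeodesic γ M) (hL : 0 ≤ L) (hM : 0 ≤ M) (h0 : β 0 = γ 0) {p q : X} (hpq : p ≠ q)
    (hp : p ∈ β '' Icc 0 L ∪ γ '' Icc 0 M) (hq : q ∈ β '' Icc 0 L ∪ γ '' Icc 0 M) :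
    HasArc p q (β '' Icc 0 L ∪ γ '' Icc 0 M) (L + M) := by
  by_cases h1 : p ∈ β '' Icc 0 L ∧ q ∈ β '' Icc 0 L
  · obtain ⟨⟨b, hb, rfl⟩, c, hc, rfl⟩ := h1
    exact (hβ.hasArc' hb hc fun h => hpq (by rw [h])).mono subset_union_left (by linarith)
  by_cases h2 : p ∈ γ '' Icc 0 M ∧ q ∈ γ '' Icc 0 M
  · obtain ⟨⟨b, hb, rfl⟩, c, hc, rfl⟩ := h2
    exact (hγ.hasArc' hb hc fun h => hpq (by rw [h])).mono subset_union_right (by linarith)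
  rcases hp with hp | hp
  · have hq' := hq.resolve_left fun h => h1 ⟨hp, h⟩
    have hp' : p ∉ γ '' Icc 0 M := fun h => h2 ⟨h, hq'⟩
    have hq'' : q ∉ β '' Icc 0 L := fun h => h1 ⟨hp, h⟩
    obtain ⟨b, hb, rfl⟩ := hp
    obtain ⟨c, hc, rfl⟩ := hq'
    exact hβ.hasArc_of_notMem hγ h0 hb hc hp' hq''
  · have hq' := hq.resolve_right fun h => h2 ⟨hp, h⟩
    have hp' : p ∉ β '' Icc 0 L := fun h => h1 ⟨h, hq'⟩
    have hq'' : q ∉ γ '' Icc 0 M := fun h => h2 ⟨hp, h⟩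
    obtain ⟨b, hb, rfl⟩ := hp
    obtain ⟨c, hc, rfl⟩ := hq'
    exact (hβ.hasArc_of_notMem hγ h0 hc hb hq'' hp').symm

lemma IsGeodesic.exists_first {α : ℝ → X} {L : ℝ} (hα : IsGeodesic α L) (hL : 0 ≤ L) {Q : Set X}
    (hQ : IsClosed Q) (h0 : α 0 ∉ Q) (h1 : α L ∈ Q) :
    ∃ u, 0 < u ∧ u ≤ L ∧ α u ∈ Q ∧ ∀ s ∈ Icc 0 u, α s ∈ Q → s = u := by
  have := hα.lipschitzOnWith.continuousOn.preimage_isClosed_of_isClosed isClosed_Icc hQ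
  obtain ⟨u, ⟨hu, huQ⟩, hmin⟩ := (isCompact_Icc.of_isClosed_subset this fun _ h => h.1).exists_isLeast
    ⟨L, ⟨hL, le_rfl⟩, h1⟩
  refine ⟨u, hu.1.lt_of_ne ?_, hu.2, huQ, fun s hs hsQ => ?_⟩
  · rintro rfl
    exact h0 huQ
  · exact le_antisymm hs.2 (hmin ⟨⟨hs.1, hs.2.trans hu.2⟩, hsQ⟩)

/-- A geodesic space without short simple loops is treelike at small scale. -/
theorem isTreelike_of_loops {D : ℝ}
    (hgeod : ∀ x y : X, ∃ α : ℝ → X, α 0 = x ∧ α (dist x y) = y ∧ IsGeodesic α (dist x y))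
    (hloop : ∀ (x : X) (γ : Path x x), InjOn γ (Ico 0 1) → ENNReal.ofReal (3 * D) ≤ curveLength γ) :
    IsTreelike X D := by
  constructor
  · intro x y t
    obtain ⟨α, h0, h1, hα⟩ := hgeod x y
    have hd : 0 ≤ dist x y := dist_nonneg
    have ht0 := t.2.1
    have ht1 := t.2.2
    have ht : t * dist x y ∈ Icc 0 (dist x y) := ⟨by positivity, by nlinarith⟩
    refine ⟨α (t * dist x y), ?_, ?_⟩
    · have e := hα 0 ⟨le_rfl, hd⟩ _ ht
      rwa [h0, zero_sub, abs_neg, abs_of_nonneg ht.1] at e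
    · have e := hα _ ht _ ⟨hd, le_rfl⟩
      rw [h1, abs_of_nonpos (by linarith [ht.2])] at e
      rw [e]; ring
  · intro x y z m hxy hyz hxz hm
    by_contra! H
    obtain ⟨β, hβ0, hβ1, hβ⟩ := hgeod z x
    obtain ⟨γ, hγ0, hγ1, hγ⟩ := hgeod z y
    obtain ⟨α, hα0, hα1, hα⟩ := hgeod m x
    obtain ⟨α', hα'0, hα'1, hα'⟩ := hgeod m y
    have nn : ∀ a b : X, 0 ≤ dist a b := fun _ _ => dist_nonneg
    have hbetw : ∀ {δ : ℝ → X} {w : X}, δ 0 = z → δ (dist z w) = w → IsGeodesic δ (dist z w) →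
        m ∈ δ '' Icc 0 (dist z w) → dist w m + dist m z = dist w z := by
      rintro δ w h0 h1 hδ ⟨u, hu, rfl⟩
      have e1 := hδ 0 ⟨le_rfl, nn _ _⟩ u hu
      have e2 := hδ u hu _ ⟨nn _ _, le_rfl⟩
      rw [h0, zero_sub, abs_neg, abs_of_nonneg hu.1] at e1
      rw [h1, abs_of_nonpos (by linarith [hu.2])] at e2
      rw [dist_comm w, e2, dist_comm _ z, e1, dist_comm w]; ring
    -- `Q` is the union of the two other sides. If the tripod property fails, `m` misses `Q`;
    -- following the side through `m` in both directions until it first hits `Q`, and closing up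
    -- inside `Q`, produces a simple loop no longer than the perimeter.
    set Q := β '' Icc 0 (dist z x) ∪ γ '' Icc 0 (dist z y) with hQdef
    have hQ : IsClosed Q :=
      ((isCompact_Icc.image_of_continuousOn hβ.lipschitzOnWith.continuousOn).union
        (isCompact_Icc.image_of_continuousOn hγ.lipschitzOnWith.continuousOn)).isClosed
    have hmQ : m ∉ Q := by
      rintro (h | h)
      · exact H.1 (hbetw hβ0 hβ1 hβ h)
      · exact H.2 (hbetw hγ0 hγ1 hγ h)
    have hxQ : x ∈ Q := Or.inl ⟨_, ⟨nn _ _, le_rfl⟩, hβ1⟩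
    have hyQ : y ∈ Q := Or.inr ⟨_, ⟨nn _ _, le_rfl⟩, hγ1⟩
    obtain ⟨u, hu0, huL, huQ, hu⟩ := hα.exists_first (nn _ _) hQ (by rwa [hα0]) (by rwa [hα1])
    obtain ⟨v, hv0, hvL, hvQ, hv⟩ := hα'.exists_first (nn _ _) hQ (by rwa [hα'0]) (by rwa [hα'1])
    -- The two halves of the side meet only at `m`, since another meeting point would be a shortcut
    -- from `x` to `y`.
    have hdist : ∀ s ∈ Icc 0 (dist m x), ∀ t ∈ Icc 0 (dist m y), α s = α' t → s = 0 := by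
      intro s hs t ht hst
      have e1 := hα s hs _ ⟨nn _ _, le_rfl⟩
      have e2 := hα' t ht _ ⟨nn _ _, le_rfl⟩
      rw [hα1, abs_of_nonpos (by linarith [hs.2])] at e1
      rw [hα'1, abs_of_nonpos (by linarith [ht.2])] at e2
      have := dist_triangle x (α s) y
      rw [dist_comm x (α s), e1, hst, e2, ← hm, dist_comm x m] at this
      linarith [hs.1, ht.1]
    have a1 := (hα.hasArc le_rfl hu0 huL).symm
    have a2 := hα'.hasArc le_rfl hv0 hvL
    rw [hα0] at a1
    rw [hα'0] at a2
    have a3 := a1.trans a2 (by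
      rintro _ ⟨⟨s, hs, rfl⟩, t, ht, hst⟩
      have := hdist s ⟨hs.1, hs.2.trans huL⟩ t ⟨ht.1, ht.2.trans hvL⟩ hst.symm
      rw [this, hα0]; rfl) (by linarith) (by linarith)
    have hne : α u ≠ α' v := fun h =>
      hu0.ne' (hdist u ⟨hu0.le, huL⟩ v ⟨hv0.le, hvL⟩ h)
    have a4 := (hβ.hasArc_union hγ (nn _ _) (nn _ _) (hβ0.trans hγ0.symm) hne huQ hvQ).symm
    obtain ⟨δ, hδ, hδL⟩ := a3.exists_loop a4 (by
      rintro _ ⟨⟨s, hs, rfl⟩ | ⟨s, hs, rfl⟩, h⟩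
      · rw [hu s hs h]; exact Or.inl rfl
      · rw [hv s hs h]; exact Or.inr rfl) (by linarith) (by linarith [nn z x, nn z y])
    have h1 := (hloop _ δ hδ).trans hδL
    rw [ENNReal.ofReal_le_ofReal_iff (by linarith [nn z x, nn z y])] at h1
    rw [dist_comm z x, dist_comm z y] at h1
    rw [dist_comm m x] at huL
    linarith

end tripod

/-! ### The length metric and arc length -/

section lengthDist

variable {E : Type*} [MetricSpace E] {A : Set E} {a b c : E}

lemma lengthDist_le (γ : Path a b) (h : ∀ t, γ t ∈ A) : lengthDist A a b ≤ curveLength γ :=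
  iInf₂_le γ h

lemma edist_le_lengthDist (A : Set E) (a b : E) : edist a b ≤ lengthDist A a b := by
  refine le_iInf₂ fun γ _ => ?_
  have := eVariationOn.edist_le γ (mem_univ (0 : I)) (mem_univ 1)
  rwa [γ.source, γ.target] at this

lemma lengthDist_self (ha : a ∈ A) : lengthDist A a a = 0 := by
  refine le_antisymm ((lengthDist_le (Path.refl a) fun _ => ha).trans ?_) zero_le
  exact (eVariationOn.constant_on (f := Path.refl a) (by
    rw [image_univ, Path.refl_range]; exact subsingleton_singleton)).le

lemma lengthDist_comm_le (A : Set E) (a b : E) : lengthDist A a b ≤ lengthDist A b a :=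
  le_iInf₂ fun γ h => (lengthDist_le γ.symm fun _ => h _).trans (curveLength_symm γ)

lemma lengthDist_comm (A : Set E) (a b : E) : lengthDist A a b = lengthDist A b a :=
  le_antisymm (lengthDist_comm_le A a b) (lengthDist_comm_le A b a)

lemma lengthDist_triangle (A : Set E) (a b c : E) :
    lengthDist A a c ≤ lengthDist A a b + lengthDist A b c := by
  rw [lengthDist, lengthDist, lengthDist]
  simp only [ENNReal.iInf_add, ENNReal.add_iInf]
  refine le_iInf₂ fun γ' h' => le_iInf₂ fun γ h => ?_
  refine (lengthDist_le (γ.trans γ') fun t => ?_).trans (curveLength_trans γ γ')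
  rcases γ.trans_eq_or γ' t with ⟨u, -, hu⟩ | ⟨u, -, -, hu⟩ <;> rw [hu]
  exacts [h u, h' u]

lemma lengthDist_le_eVariationOn {e : I → E} (he : Continuous e) (hA : ∀ t, e t ∈ A) {s t : I}
    (hst : s ≤ t) : lengthDist A (e s) (e t) ≤ eVariationOn e (Icc s t) := by
  let φ : I → I := fun u => projIcc 0 1 zero_le_one ((s : ℝ) + (t - s) * u)
  have hst' : (s : ℝ) ≤ t := hst
  have hφm : Monotone φ := fun u v huv => by
    refine monotone_projIcc _ ?_
    have : (u : ℝ) ≤ v := huv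
    nlinarith
  have hφ0 : φ 0 = s := by simp [φ]
  have hφ1 : φ 1 = t := by simp [φ]
  have hφc : Continuous φ := continuous_projIcc.comp (by fun_prop)
  let γ : Path (e s) (e t) :=
    { toFun := e ∘ φ
      continuous_toFun := he.comp hφc
      source' := by simp [hφ0]
      target' := by simp [hφ1] }
  refine (lengthDist_le γ fun u => hA _).trans ?_
  refine eVariationOn.comp_le_of_monotoneOn e φ (hφm.monotoneOn _) fun u _ => ⟨?_, ?_⟩
  · rw [← hφ0]; exact hφm u.2.1
  · rw [← hφ1]; exact hφm u.2.2

lemma lengthDist_le_eVariationOn_uIcc {e : I → E} (he : Continuous e) (hA : ∀ t, e t ∈ A)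
    (s t : I) : lengthDist A (e s) (e t) ≤ eVariationOn e (uIcc s t) := by
  rcases le_total s t with h | h
  · rw [uIcc_of_le h]; exact lengthDist_le_eVariationOn he hA h
  · rw [uIcc_of_ge h, lengthDist_comm]; exact lengthDist_le_eVariationOn he hA h

/-- Near a point of continuity, a curve of bounded variation has small variation. Thus edges remain
continuous for the length metric, which gives its compactness. -/
lemma tendsto_eVariationOn_uIcc {e : I → E} (he : Continuous e)
    (hv : eVariationOn e univ ≠ ∞) (x : I) :
    Tendsto (fun y => eVariationOn e (uIcc y x)) (𝓝 x) (𝓝 0) := by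
  have h1 := BoundedVariationOn.tendsto_eVariationOn_Icc_zero_left (f := e) (s := univ) hv
    (x := x) he.continuousWithinAt
  have h2 := BoundedVariationOn.tendsto_eVariationOn_Icc_zero_right (f := e) (s := univ) hv
    x he.continuousWithinAt
  simp only [univ_inter, nhdsWithin_univ] at h1 h2
  have h3 := h1.add h2
  rw [add_zero] at h3
  refine tendsto_of_tendsto_of_tendsto_of_le_of_le tendsto_const_nhds h3 (fun _ => zero_le) ?_
  intro y
  rcases le_total y x with h | h
  · simp only [uIcc_of_le h]; exact le_self_add
  · simp only [uIcc_of_ge h]; exact le_add_self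

lemma eVariationOn_uIcc_eq {e : I → E} (hv : eVariationOn e univ ≠ ∞) (s t : I) :
    eVariationOn e (uIcc s t) = ENNReal.ofReal
      |(eVariationOn e (Icc 0 s)).toReal - (eVariationOn e (Icc 0 t)).toReal| := by
  have hfin : ∀ B : Set I, eVariationOn e B ≠ ∞ := fun B =>
    ((eVariationOn.mono e (subset_univ B)).trans_lt hv.lt_top).ne
  have key : ∀ s t : I, s ≤ t → eVariationOn e (Icc s t) = ENNReal.ofReal
      ((eVariationOn e (Icc 0 t)).toReal - (eVariationOn e (Icc 0 s)).toReal) := by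
    intro s t hst
    have := eVariationOn.Icc_add_Icc e (s := univ) (show 0 ≤ s from s.2.1) hst (mem_univ s)
    simp only [univ_inter] at this
    change eVariationOn e (Icc 0 s) + _ = eVariationOn e (Icc 0 t) at this
    rw [← this, ENNReal.toReal_add (hfin _) (hfin _), add_sub_cancel_left,
      ENNReal.ofReal_toReal (hfin _)]
  have hmono : ∀ s t : I, s ≤ t → (eVariationOn e (Icc 0 s)).toReal ≤
      (eVariationOn e (Icc 0 t)).toReal := fun s t hst =>
    ENNReal.toReal_mono (hfin _) (eVariationOn.mono e (Icc_subset_Icc_right hst))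
  rcases le_total s t with h | h
  · rw [uIcc_of_le h, key s t h, abs_of_nonpos (by linarith [hmono s t h]), neg_sub]
  · rw [uIcc_of_ge h, key t s h, abs_of_nonneg (by linarith [hmono t s h])]

lemma continuous_toReal_eVariationOn {e : I → E} (he : Continuous e)
    (hv : eVariationOn e univ ≠ ∞) : Continuous fun t => (eVariationOn e (Icc 0 t)).toReal := by
  rw [continuous_iff_continuousAt]
  intro x
  have := tendsto_eVariationOn_uIcc he hv x
  simp only [eVariationOn_uIcc_eq hv] at this
  have h2 := (ENNReal.tendsto_toReal ENNReal.zero_ne_top).comp this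
  rw [ContinuousAt, tendsto_iff_dist_tendsto_zero]
  refine h2.congr fun y => ?_
  rw [Function.comp_apply, ENNReal.toReal_ofReal (abs_nonneg _), Real.dist_eq]

/-- Reparametrization of a path of finite length proportionally to arc length. -/
lemma exists_proportional_reparam (γ : Path a b) (hA : ∀ t, γ t ∈ A)
    (hv : curveLength γ ≠ ∞) : ∃ f : I → E, f 0 = a ∧ f 1 = b ∧ (∀ t, f t ∈ A) ∧
      ∀ s t : I, lengthDist A (f s) (f t) ≤
        ENNReal.ofReal (|(s : ℝ) - t| * (curveLength γ).toReal) := by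
  let v : I → ℝ := fun t => (eVariationOn γ (Icc 0 t)).toReal
  have hvc : Continuous v := continuous_toReal_eVariationOn γ.continuous hv
  have hv0 : v 0 = 0 := by simp [v, eVariationOn.subsingleton]
  have hv1 : v 1 = (curveLength γ).toReal := by
    have : Icc (0 : I) 1 = univ := eq_univ_of_forall fun u => u.2
    simp only [v, this, curveLength]
  -- Arc length may be constant on an interval, so the preimages of 0 and of the total length need
  -- not be unique; the endpoints are prescribed by hand. Continuity of the choice is not needed, as
  -- the distance bound implies it.
  have hex : ∀ s : I, ∃ t : I, v t = s * (curveLength γ).toReal ∧ (s = 0 → t = 0) ∧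
      (s = 1 → t = 1) := by
    intro s
    by_cases hs0 : s = 0
    · subst hs0; exact ⟨0, by simp [hv0], by simp, by simp⟩
    by_cases hs1 : s = 1
    · subst hs1; exact ⟨1, by simp [hv1], by simp, by simp⟩
    have := intermediate_value_Icc (zero_le_one' I) hvc.continuousOn
    rw [hv0, hv1] at this
    obtain ⟨t, -, ht⟩ := this (show (s : ℝ) * (curveLength γ).toReal ∈ _ from
      ⟨mul_nonneg s.2.1 ENNReal.toReal_nonneg, mul_le_of_le_one_left ENNReal.toReal_nonneg s.2.2⟩)
    exact ⟨t, ht, fun h => absurd h hs0, fun h => absurd h hs1⟩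
  choose τ hτ hτ0 hτ1 using hex
  refine ⟨fun s => γ (τ s), by simp [hτ0], by simp [hτ1], fun t => hA _, fun s t => ?_⟩
  refine (lengthDist_le_eVariationOn_uIcc γ.continuous hA _ _).trans ?_
  rw [eVariationOn_uIcc_eq hv]
  change ENNReal.ofReal |v (τ s) - v (τ t)| ≤ _
  rw [hτ, hτ, ← sub_mul, abs_mul, abs_of_nonneg (ENNReal.toReal_nonneg (a := curveLength γ))]

/-- An edge has finite length, so it lies entirely at finite or entirely at infinite distance from
`a`. Both classes are finite unions of closed sets, and connectedness leaves no room for the second.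
-/
lemma IsEmbeddedMetricGraph.lengthDist_ne_top {G : Set E} (hG : IsEmbeddedMetricGraph G)
    (hconn : IsConnected G) (ha : a ∈ G) (hb : b ∈ G) : lengthDist G a b ≠ ∞ := by
  classical
  obtain ⟨V, m, e, hV, -, -, -, hlen, hGeq⟩ := hG
  have heG : ∀ i t, e i t ∈ G := fun i t => by
    rw [hGeq]; exact Or.inr (mem_iUnion.2 ⟨i, mem_range_self t⟩)
  have hedge : ∀ i t, lengthDist G (e i 0) (e i t) ≠ ∞ := fun i t =>
    ((lengthDist_le_eVariationOn_uIcc (e i).continuous (heG i) 0 t).trans_lt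
      ((eVariationOn.mono _ (subset_univ _)).trans_lt (hlen i).lt_top)).ne
  have hiff : ∀ i t, lengthDist G a (e i t) ≠ ∞ ↔ lengthDist G a (e i 0) ≠ ∞ := by
    intro i t
    constructor <;> intro h
    · refine ne_top_of_le_ne_top ?_ (lengthDist_triangle G a (e i t) (e i 0))
      rw [lengthDist_comm G (e i t)]
      exact ENNReal.add_ne_top.2 ⟨h, hedge i t⟩
    · exact ne_top_of_le_ne_top (ENNReal.add_ne_top.2 ⟨h, hedge i t⟩)
        (lengthDist_triangle G a (e i 0) (e i t))
  have hclosed : ∀ P : E → Prop,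
      IsClosed ((V.filter P : Set E) ∪ ⋃ i ∈ {i | P (e i 0)}, range (e i)) := fun P =>
    (V.filter P).finite_toSet.isClosed.union
      ((toFinite _).isClosed_biUnion fun i _ => (isCompact_range (e i).continuous).isClosed)
  have hmem : ∀ P : E → Prop, (∀ i t, P (e i t) ↔ P (e i 0)) →
      ∀ x ∈ (V.filter P : Set E) ∪ ⋃ i ∈ {i | P (e i 0)}, range (e i), P x := by
    rintro P hP x (hx | hx)
    · exact (Finset.mem_filter.1 hx).2
    · obtain ⟨i, hi, t, rfl⟩ := mem_iUnion₂.1 hx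
      exact (hP i t).2 hi
  have hmem' : ∀ P : E → Prop, (∀ i t, P (e i t) ↔ P (e i 0)) → ∀ x ∈ G, P x →
      x ∈ (V.filter P : Set E) ∪ ⋃ i ∈ {i | P (e i 0)}, range (e i) := by
    intro P hP x hx hPx
    rw [hGeq] at hx
    rcases hx with hx | hx
    · exact Or.inl (Finset.mem_filter.2 ⟨hx, hPx⟩)
    · obtain ⟨i, t, rfl⟩ := mem_iUnion.1 hx
      exact Or.inr (mem_iUnion₂.2 ⟨i, (hP i t).1 hPx, t, rfl⟩)
  have hiff' : ∀ i t, ¬ lengthDist G a (e i t) ≠ ∞ ↔ ¬ lengthDist G a (e i 0) ≠ ∞ := fun i t =>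
    not_congr (hiff i t)
  by_contra hab
  obtain ⟨x, -, hx1, hx2⟩ := isPreconnected_closed_iff.1 hconn.isPreconnected _ _
    (hclosed fun x => lengthDist G a x ≠ ∞) (hclosed fun x => ¬ lengthDist G a x ≠ ∞)
    (fun x hx => by
      by_cases h : lengthDist G a x ≠ ∞
      · exact Or.inl (hmem' _ hiff x hx h)
      · exact Or.inr (hmem' (fun x => ¬ lengthDist G a x ≠ ∞) hiff' x hx h))
    ⟨a, ha, hmem' _ hiff a ha (by rw [lengthDist_self ha]; exact ENNReal.zero_ne_top)⟩
    ⟨b, hb, hmem' (fun x => ¬ lengthDist G a x ≠ ∞) hiff' b hb (not_not.2 hab)⟩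
  exact hmem _ hiff' x hx2 (hmem _ hiff x hx1)

end lengthDist

/-! ### The graph as a compact geodesic space -/

/-- A subset of a metric space, to be endowed with its length metric. -/
def LengthSpace {E : Type*} (A : Set E) : Type _ := A

namespace LengthSpace

variable {E : Type*} [MetricSpace E] {A : Set E}

/-- The length metric of a subset in which all points are joined by paths of finite length. -/
@[reducible]
noncomputable def metricSpace (hA : ∀ a ∈ A, ∀ b ∈ A, lengthDist A a b ≠ ∞) :
    MetricSpace (LengthSpace A) where
  dist a b := (lengthDist A a.1 b.1).toReal
  dist_self a := by rw [lengthDist_self a.2, ENNReal.toReal_zero]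
  dist_comm a b := by rw [lengthDist_comm]
  dist_triangle a b c := by
    rw [← ENNReal.toReal_add (hA _ a.2 _ b.2) (hA _ b.2 _ c.2)]
    exact ENNReal.toReal_mono (ENNReal.add_ne_top.2 ⟨hA _ a.2 _ b.2, hA _ b.2 _ c.2⟩)
      (lengthDist_triangle A _ _ _)
  eq_of_dist_eq_zero {a b} h := by
    rcases (ENNReal.toReal_eq_zero_iff _).1 h with h | h
    · have := (edist_le_lengthDist A a.1 b.1).trans h.le
      exact Subtype.ext (edist_eq_zero.1 (le_antisymm this zero_le))
    · exact absurd h (hA _ a.2 _ b.2)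

end LengthSpace

/-- A connected embedded metric graph with its length metric is a compact geodesic space, which is
homeomorphic to the graph with the induced topology. -/
theorem IsEmbeddedMetricGraph.exists_lengthSpace {E : Type u} [MetricSpace E] {G : Set E}
    (hG : IsEmbeddedMetricGraph G) (hconn : IsConnected G) :
    ∃ (X : Type u) (_ : MetricSpace X) (_ : CompactSpace X) (φ : X ≃ₜ G),
      (∀ x y, ENNReal.ofReal (dist x y) = lengthDist G (φ x : E) (φ y)) ∧
      ∀ x y : X, ∃ α : ℝ → X, α 0 = x ∧ α (dist x y) = y ∧ IsGeodesic α (dist x y) := by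
  have hfin : ∀ a ∈ G, ∀ b ∈ G, lengthDist G a b ≠ ∞ := fun a ha b hb =>
    hG.lengthDist_ne_top hconn ha hb
  let _ : MetricSpace (LengthSpace G) := LengthSpace.metricSpace hfin
  have hdist : ∀ x y : LengthSpace G, dist x y = (lengthDist G x.1 y.1).toReal := fun _ _ => rfl
  have hdist' : ∀ x y : LengthSpace G, ENNReal.ofReal (dist x y) = lengthDist G x.1 y.1 :=
    fun x y => ENNReal.ofReal_toReal (hfin _ x.2 _ y.2)
  have hcompact : CompactSpace (LengthSpace G) := by
    obtain ⟨V, m, e, hV, -, -, -, hlen, hGeq⟩ := hG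
    have heG : ∀ i t, e i t ∈ G := fun i t => by
      rw [hGeq]; exact Or.inr (mem_iUnion.2 ⟨i, mem_range_self t⟩)
    have hVG : ∀ v ∈ V, v ∈ G := fun v hv => by rw [hGeq]; exact Or.inl hv
    let e' : Fin m → I → LengthSpace G := fun i t => ⟨e i t, heG i t⟩
    have he' : ∀ i, Continuous (e' i) := by
      intro i
      rw [continuous_iff_continuousAt]
      intro x
      rw [ContinuousAt, tendsto_iff_dist_tendsto_zero]
      have h1 := (ENNReal.tendsto_toReal ENNReal.zero_ne_top).comp
        (tendsto_eVariationOn_uIcc (e i).continuous (hlen i) x)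
      refine squeeze_zero (fun _ => dist_nonneg) (fun y => ?_) h1
      exact ENNReal.toReal_mono
        ((eVariationOn.mono _ (subset_univ _)).trans_lt (hlen i).lt_top).ne
        (lengthDist_le_eVariationOn_uIcc (e i).continuous (heG i) y x)
    have huniv : (univ : Set (LengthSpace G)) =
        range (fun v : V => (⟨v.1, hVG v.1 v.2⟩ : LengthSpace G)) ∪ ⋃ i, range (e' i) := by
      refine (eq_univ_of_forall fun x => ?_).symm
      rcases hGeq.subset x.2 with hx | hx
      · exact Or.inl ⟨⟨x.1, hx⟩, rfl⟩
      · obtain ⟨i, t, ht⟩ := mem_iUnion.1 hx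
        exact Or.inr (mem_iUnion.2 ⟨i, t, Subtype.ext ht⟩)
    refine ⟨?_⟩
    rw [huniv]
    exact (finite_range _).isCompact.union (isCompact_iUnion fun i => isCompact_range (he' i))
  have hcont : Continuous (fun x : LengthSpace G => (⟨x.1, x.2⟩ : G)) := by
    refine Continuous.subtype_mk ?_ _
    have : LipschitzWith 1 (fun x : LengthSpace G => x.1) := by
      refine LipschitzWith.of_edist_le fun x y => ?_
      rw [edist_dist x y, hdist']
      exact edist_le_lengthDist G _ _
    exact this.continuous
  let ψ : LengthSpace G ≃ G := ⟨fun x => ⟨x.1, x.2⟩, fun x => ⟨x.1, x.2⟩, fun _ => rfl, fun _ => rfl⟩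
  have hψ : Continuous ψ := hcont
  refine ⟨LengthSpace G, inferInstance, hcompact, hψ.homeoOfEquivCompactToT2, hdist', ?_⟩
  intro x y
  have hd : 0 ≤ dist x y := dist_nonneg
  have happrox : ∀ η > 0, ∃ f : I → LengthSpace G, f 0 = x ∧ f 1 = y ∧
      ∀ s t : I, dist (f s) (f t) ≤ |(s : ℝ) - t| * (dist x y + η) := by
    intro η hη
    have h1 : lengthDist G x.1 y.1 < ENNReal.ofReal (dist x y + η) := by
      rw [← hdist']
      exact (ENNReal.ofReal_lt_ofReal_iff (by linarith)).2 (by linarith)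
    obtain ⟨γ, hγ⟩ := iInf_lt_iff.1 h1
    obtain ⟨hγG, hγ⟩ := iInf_lt_iff.1 hγ
    obtain ⟨f, hf0, hf1, hfG, hf⟩ := exists_proportional_reparam γ hγG hγ.ne_top
    refine ⟨fun t => ⟨f t, hfG t⟩, Subtype.ext hf0, Subtype.ext hf1, fun s t => ?_⟩
    refine (ENNReal.toReal_mono ENNReal.ofReal_ne_top (hf s t)).trans ?_
    rw [ENNReal.toReal_ofReal (mul_nonneg (abs_nonneg _) ENNReal.toReal_nonneg)]
    refine mul_le_mul_of_nonneg_left ?_ (abs_nonneg _)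
    exact ENNReal.toReal_le_of_le_ofReal (by linarith) hγ.le
  -- Almost shortest paths with proportional parametrization form a decreasing sequence of nonempty
  -- closed subsets of the compact product `I → X`. A common element is Lipschitz with constant the
  -- distance of its endpoints.
  let T : ℕ → Set (I → LengthSpace G) := fun n => {f | f 0 = x ∧ f 1 = y ∧
      ∀ s t : I, dist (f s) (f t) ≤ |(s : ℝ) - t| * (dist x y + 1 / ((n : ℝ) + 1))}
  have hTclosed : ∀ n, IsClosed (T n) := by
    intro n
    have : T n = {f | f 0 = x} ∩ ({f | f 1 = y} ∩ ⋂ s : I, ⋂ t : I,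
        {f | dist (f s) (f t) ≤ |(s : ℝ) - t| * (dist x y + 1 / ((n : ℝ) + 1))}) := by
      ext f; simp only [T, mem_inter_iff, mem_iInter, mem_ofPred_eq]
    rw [this]
    refine (isClosed_eq (continuous_apply 0) continuous_const).inter
      ((isClosed_eq (continuous_apply 1) continuous_const).inter
        (isClosed_iInter fun s => isClosed_iInter fun t => ?_))
    exact isClosed_le ((continuous_apply s).dist (continuous_apply t)) continuous_const
  obtain ⟨f, hf⟩ := IsCompact.nonempty_iInter_of_sequence_nonempty_isCompact_isClosed T
    (fun n f hf => ⟨hf.1, hf.2.1, fun s t => (hf.2.2 s t).trans (by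
      push_cast
      gcongr
      linarith)⟩)
    (fun n => happrox _ (by positivity)) (hTclosed 0).isCompact hTclosed
  rw [mem_iInter] at hf
  have hf0 : f 0 = x := (hf 0).1
  have hf1 : f 1 = y := (hf 0).2.1
  have hfd : ∀ s t : I, dist (f s) (f t) ≤ |(s : ℝ) - t| * dist x y := by
    intro s t
    have h1 : Tendsto (fun n : ℕ => |(s : ℝ) - t| * (dist x y + 1 / ((n : ℝ) + 1))) atTop
        (𝓝 (|(s : ℝ) - t| * (dist x y + 0))) :=
      (tendsto_const_nhds.add tendsto_one_div_add_atTop_nhds_zero_nat).const_mul _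
    rw [add_zero] at h1
    exact ge_of_tendsto' h1 fun n => (hf n).2.2 s t
  rcases hd.eq_or_lt with h0 | hpos
  · refine ⟨fun _ => x, rfl, dist_eq_zero.1 h0.symm, fun s hs t ht => ?_⟩
    rw [← h0] at hs ht
    have e1 : s = 0 := le_antisymm hs.2 hs.1
    have e2 : t = 0 := le_antisymm ht.2 ht.1
    simp [e1, e2]
  · have hp : ∀ s ∈ Icc 0 (dist x y), s / dist x y ∈ Icc (0 : ℝ) 1 := fun s hs =>
      ⟨div_nonneg hs.1 hd, div_le_one_of_le₀ hs.2 hd⟩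
    let α : ℝ → LengthSpace G := fun u => f (projIcc 0 1 zero_le_one (u / dist x y))
    have hα0 : α 0 = x := by simp [α, hf0]
    have hα1 : α (dist x y) = y := by simp [α, hf1, div_self hpos.ne']
    have hle : ∀ s ∈ Icc 0 (dist x y), ∀ t ∈ Icc 0 (dist x y), dist (α s) (α t) ≤ |s - t| := by
      intro s hs t ht
      refine (hfd _ _).trans ?_
      rw [projIcc_of_mem _ (hp s hs), projIcc_of_mem _ (hp t ht), ← sub_div, abs_div,
        abs_of_pos hpos, div_mul_cancel₀ _ hpos.ne']
    -- If the curve gained less than `|s - t|` anywhere, the triangle inequality would make its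
    -- endpoints too close.
    have hge : ∀ s ∈ Icc 0 (dist x y), ∀ t ∈ Icc 0 (dist x y), s ≤ t →
        dist (α s) (α t) = |s - t| := by
      intro s hs t ht hst
      refine le_antisymm (hle s hs t ht) ?_
      have h1 := hle 0 ⟨le_rfl, hd⟩ s hs
      have h2 := hle t ht _ ⟨hd, le_rfl⟩
      rw [hα0, zero_sub, abs_neg, abs_of_nonneg hs.1] at h1
      rw [hα1, abs_of_nonpos (by linarith [ht.2])] at h2
      have := dist_triangle4 x (α s) (α t) y
      rw [abs_of_nonpos (by linarith)]
      linarith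
    refine ⟨α, hα0, hα1, fun s hs t ht => ?_⟩
    rcases le_total s t with h | h
    · exact hge s hs t ht h
    · rw [dist_comm, abs_sub_comm]; exact hge t ht s hs h

/-! ### Comparing the thickening with ε-paths -/

section thickening

variable {E : Type*} [NormedAddCommGroup E] [NormedSpace ℝ E]

lemma lengthDist_le_edist_of_segment_subset {A : Set E} {a b : E} (h : segment ℝ a b ⊆ A) :
    lengthDist A a b ≤ edist a b := by
  let γ : Path a b :=
    { toFun := fun t => AffineMap.lineMap a b (t : ℝ)
      continuous_toFun := by fun_prop
      source' := by simp
      target' := by simp }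
  refine (lengthDist_le γ fun t => h ?_).trans ?_
  · rw [segment_eq_image_lineMap]
    exact mem_image_of_mem _ t.2
  · have h1 : eVariationOn (fun t : I => (t : ℝ)) univ ≤ 1 := by
      have h2 := (show MonotoneOn (fun t : I => (t : ℝ)) univ from fun _ _ _ _ h => h).eVariationOn_eq
        (mem_univ (0 : I)) (mem_univ (1 : I))
      have h3 : (univ ∩ Icc (0 : I) 1) = univ := by
        rw [univ_inter]; exact eq_univ_of_forall fun u => u.2
      rw [h3] at h2
      exact (h2.trans (by simp)).le
    refine (((lipschitzWith_lineMap a b).lipschitzOnWith (s := univ)).comp_eVariationOn_le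
      (f := AffineMap.lineMap a b) (g := fun t : I => (t : ℝ)) (s := univ)
      (mapsTo_univ _ _)).trans ?_
    rw [edist_nndist]
    exact mul_le_of_le_one_right' h1

/-- A point of the segment is within ε/2 of its nearer endpoint, which is within ε/2 of `G`. -/
lemma segment_subset_thickening {G : Set E} {ε κ : ℝ} (hκ : κ ≤ ε / 2) {p q x y : E}
    (hx : x ∈ G) (hy : y ∈ G) (hpx : dist p x < κ) (hqy : dist q y < κ) (hpq : dist p q < ε) :
    segment ℝ p q ⊆ Metric.thickening ε G := by
  intro z hz
  have h := dist_add_dist_of_mem_segment hz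
  rw [Metric.mem_thickening_iff]
  rcases le_total (dist p z) (dist z q) with h1 | h1
  · refine ⟨x, hx, (dist_triangle z p x).trans_lt ?_⟩
    rw [dist_comm z p]; linarith
  · refine ⟨y, hy, (dist_triangle z q y).trans_lt ?_⟩
    linarith

lemma lengthDist_thickening_le_epsPathDist {G S : Set E} {ε κ : ℝ} (hκ : κ ≤ ε / 2)
    (hS : ∀ p ∈ S, ∃ x ∈ G, dist p x < κ) (p q : S) :
    lengthDist (Metric.thickening ε G) (p : E) q ≤ epsPathDist S ε p q := by
  refine le_iInf fun k => le_iInf fun a => le_iInf fun h0 => le_iInf fun h1 => le_iInf fun ha => ?_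
  have hstep : ∀ i ≤ k, lengthDist (Metric.thickening ε G) (a i : E) (a (i + 1)) ≤
      edist (a i) (a (i + 1)) := by
    intro i hi
    obtain ⟨x, hx, hpx⟩ := hS _ (a i).2
    obtain ⟨y, hy, hqy⟩ := hS _ (a (i + 1)).2
    exact lengthDist_le_edist_of_segment_subset
      (segment_subset_thickening hκ hx hy hpx hqy (ha i hi))
  have hind : ∀ n ≤ k, lengthDist (Metric.thickening ε G) (a 0 : E) (a (n + 1)) ≤
      ∑ i ∈ Finset.range (n + 1), edist (a i) (a (i + 1)) := by
    intro n hn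
    induction n with
    | zero => simpa using hstep 0 hn
    | succ n ih =>
      rw [Finset.sum_range_succ]
      exact (lengthDist_triangle _ _ (a (n + 1) : E) _).trans
        (add_le_add (ih (by omega)) (hstep _ hn))
  rw [← h0, ← h1]
  exact hind k le_rfl

/-- The polygon along an ε-path runs inside the thickening; joining its ends to `x` and `y` costs κ
each. -/
lemma lengthDist_thickening_le {G S : Set E} {ε κ : ℝ} (hκ : κ ≤ ε / 2)
    (hS : ∀ p ∈ S, ∃ x ∈ G, dist p x < κ) (p q : S) {x y : E} (hx : x ∈ G) (hy : y ∈ G)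
    (hpx : dist (p : E) x < κ) (hqy : dist (q : E) y < κ) :
    lengthDist (Metric.thickening ε G) x y ≤
      epsPathDist S ε p q + ENNReal.ofReal (2 * κ) := by
  have hκ0 : 0 < κ := dist_nonneg.trans_lt hpx
  have key : ∀ {a b : E}, b ∈ G → dist a b < κ →
      lengthDist (Metric.thickening ε G) a b ≤ ENNReal.ofReal κ := by
    intro a b hb hab
    refine (lengthDist_le_edist_of_segment_subset
      (segment_subset_thickening hκ hb hb hab (by simpa using hκ0) (by linarith))).trans ?_
    rw [edist_dist]
    exact ENNReal.ofReal_le_ofReal hab.le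
  have h1 := key hx hpx
  have h2 := key hy hqy
  rw [lengthDist_comm] at h1
  have h3 := lengthDist_triangle (Metric.thickening ε G) x p y
  have h4 := lengthDist_triangle (Metric.thickening ε G) (p : E) q y
  have h5 := lengthDist_thickening_le_epsPathDist hκ hS p q
  calc lengthDist (Metric.thickening ε G) x y
      ≤ ENNReal.ofReal κ + (epsPathDist S ε p q + ENNReal.ofReal κ) :=
        h3.trans (add_le_add h1 (h4.trans (add_le_add h5 h2)))
    _ = epsPathDist S ε p q + ENNReal.ofReal (2 * κ) := by
        rw [two_mul, ENNReal.ofReal_add hκ0.le hκ0.le]; ring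

end thickening

/-! ### Metric comparison of sample and graph, and the theorem -/

lemma mem_faces_vietorisRips {X : Type*} {d : X → X → ℝ≥0∞} {β : ℝ≥0∞} (hβ : 0 < β)
    (s : Finset X) :
    s ∈ (vietorisRips d β).faces ↔ s.Nonempty ∧ ∀ p ∈ s, ∀ q ∈ s, d p q < β := by
  change s.Nonempty ∧ _ < β ↔ _
  simp only [Finset.sup_lt_iff (bot_lt_iff_ne_bot.2 hβ.ne')]

/-- Points near the ends of a geodesic of length `r` are close in the `ε`-path metric. -/
lemma epsPathDist_le_of_isGeodesic {E X : Type*} [MetricSpace E] [MetricSpace X] {S : Set E}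
    {φ : X → E} (hφ : ∀ x y, dist (φ x) (φ y) ≤ dist x y) {ε κ r : ℝ}
    (hκε : 2 * κ < ε) (hS : ∀ x, ∃ p : S, dist (p : E) (φ x) < κ) {α : ℝ → X} (hr : 0 ≤ r)
    (hα : IsGeodesic α r) {p q : S} (hp : dist (p : E) (φ (α 0)) < κ)
    (hq : dist (q : E) (φ (α r)) < κ) :
    epsPathDist S ε p q ≤ ENNReal.ofReal (r + 2 * κ * (r / (ε - 2 * κ) + 1)) := by
  classical
  have hκ0 : 0 < κ := dist_nonneg.trans_lt hp
  choose s hs using hS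
  -- The geodesic is cut into k + 1 equal pieces, each shorter than ε - 2κ. Replacing division
  -- points by samples adds at most 2κ per piece, so every step stays below ε.
  let k := ⌊r / (ε - 2 * κ)⌋₊
  have hpos : 0 < ε - 2 * κ := by linarith
  have hk0 : (0 : ℝ) < (k : ℝ) + 1 := by positivity
  have hk1 : (k : ℝ) ≤ r / (ε - 2 * κ) := Nat.floor_le (div_nonneg hr hpos.le)
  have hk2 : r / (k + 1) < ε - 2 * κ := by
    have := Nat.lt_floor_add_one (r / (ε - 2 * κ))
    rw [div_lt_iff₀ hpos] at this
    rw [div_lt_iff₀ hk0]; linarith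
  let u : ℕ → ℝ := fun i => i * (r / (k + 1))
  have hu : ∀ i ≤ k + 1, u i ∈ Icc 0 r := by
    intro i hi
    have h1 : (i : ℝ) ≤ k + 1 := by exact_mod_cast hi
    refine ⟨by simp only [u]; positivity, ?_⟩
    calc u i ≤ (k + 1) * (r / (k + 1)) := by simp only [u]; gcongr
      _ = r := by field_simp
  let a : ℕ → S := fun i => if i = 0 then p else if i = k + 1 then q else s (α (u i))
  have ha : ∀ i, dist (a i : E) (φ (α (u i))) < κ := by
    intro i
    simp only [a]
    split_ifs with h1 h2
    · simpa [h1, u] using hp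
    · have : u i = r := by simp only [u, h2]; push_cast; field_simp
      rw [this]; exact hq
    · exact hs _
  have hstep : ∀ i ≤ k, dist (a i) (a (i + 1)) ≤ r / (k + 1) + 2 * κ := by
    intro i hi
    have h1 := hα _ (hu i (by omega)) _ (hu (i + 1) (by omega))
    have h2 : u i - u (i + 1) = -(r / (k + 1)) := by simp only [u]; push_cast; ring
    rw [h2, abs_neg, abs_of_nonneg (by positivity)] at h1
    have h3 := dist_triangle4 (a i : E) (φ (α (u i))) (φ (α (u (i + 1)))) (a (i + 1))
    have h4 := hφ (α (u i)) (α (u (i + 1)))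
    have h5 := ha i
    have h6 := ha (i + 1)
    rw [dist_comm] at h6
    change dist (a i : E) (a (i + 1)) ≤ _
    linarith
  have ha0 : a 0 = p := by simp [a]
  have ha1 : a (k + 1) = q := by simp [a]
  have ha2 : ∀ i ≤ k, dist (a i) (a (i + 1)) < ε := fun i hi =>
    (hstep i hi).trans_lt (by linarith)
  rw [epsPathDist]
  refine iInf₂_le_of_le k a ?_
  rw [iInf_pos ha0, iInf_pos ha1, iInf_pos ha2]
  calc ∑ i ∈ Finset.range (k + 1), edist (a i) (a (i + 1))
        ≤ ∑ i ∈ Finset.range (k + 1), ENNReal.ofReal (r / (k + 1) + 2 * κ) := by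
          refine Finset.sum_le_sum fun i hi => ?_
          rw [edist_dist]
          exact ENNReal.ofReal_le_ofReal (hstep i (by rw [Finset.mem_range] at hi; omega))
      _ = ENNReal.ofReal ((k + 1) * (r / (k + 1) + 2 * κ)) := by
          rw [Finset.sum_const, Finset.card_range, nsmul_eq_mul, ENNReal.ofReal_mul hk0.le]
          congr 1
          rw [← Nat.cast_succ, ENNReal.ofReal_natCast]
      _ ≤ _ := by
          refine ENNReal.ofReal_le_ofReal ?_
          have : (k + 1) * (r / (k + 1) + 2 * κ) = r + 2 * κ * (k + 1) := by field_simp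
          rw [this]
          gcongr

lemma systole_le_curveLength {E X : Type*} [MetricSpace E] [MetricSpace X] {G : Set E}
    {φ : X → E} (hφ : ∀ x y, dist (φ x) (φ y) ≤ dist x y) (hinj : Function.Injective φ)
    (hG : ∀ x, φ x ∈ G) {x : X} (γ : Path x x) (hγ : InjOn γ (Ico 0 1)) :
    systole G ≤ curveLength γ := by
  have hL : LipschitzWith 1 φ := LipschitzWith.of_dist_le_mul fun x y => by simpa using hφ x y
  refine (iInf_le_of_le (φ x) <| iInf_le_of_le (γ.map hL.continuous) <|
    iInf_le_of_le (fun t => hG _) <| iInf_le_of_le ?_ le_rfl).trans ?_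
  · exact (hinj.injOn (s := univ)).comp hγ (mapsTo_univ _ _)
  · have := (hL.lipschitzOnWith (s := univ)).comp_eVariationOn_le (f := φ) (g := γ) (s := univ)
      (mapsTo_univ _ _)
    exact this.trans (by simp [curveLength])

/-- A pair at distance at least D > β would enter the supremum defining the distortion, which bounds
its distance by δM < D. -/
lemma dist_lt_of_largeScaleDistortion_le {E X : Type*} [MetricSpace E] [MetricSpace X] {G : Set E}
    {φ : X → G} (hφ : ∀ x y, ENNReal.ofReal (dist x y) = lengthDist G (φ x : E) (φ y))
    {ε β δ D : ℝ} (hβ : 0 < β) (hβD : β < D) (hδ0 : 0 ≤ δ)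
    (hδ : largeScaleDistortion G ε β ≤ ENNReal.ofReal δ) {M : ℝ} (hM : 0 ≤ M) (hMD : δ * M < D)
    {x y : X}
    (hxy : lengthDist (Metric.thickening ε G) (φ x : E) (φ y) ≤ ENNReal.ofReal M) :
    dist x y < D := by
  by_contra! h
  have hpos : 0 < dist x y := by linarith
  have hβxy : ENNReal.ofReal β ≤ lengthDist G (φ x : E) (φ y) := by
    rw [← hφ]; exact ENNReal.ofReal_le_ofReal (by linarith)
  have h1 : lengthDist G (φ x : E) (φ y) / lengthDist (Metric.thickening ε G) (φ x : E) (φ y) ≤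
      ENNReal.ofReal δ := by
    refine le_trans ?_ hδ
    refine le_iSup₂_of_le (φ x : E) (φ x).2 (le_iSup₂_of_le (φ y : E) (φ y).2 ?_)
    rw [iSup_pos hβxy]
  have hne : lengthDist (Metric.thickening ε G) (φ x : E) (φ y) ≠ 0 := by
    intro h0
    have h2 := (edist_le_lengthDist (Metric.thickening ε G) (φ x : E) (φ y)).trans h0.le
    have h3 : (φ x : E) = φ y := edist_eq_zero.1 (le_antisymm h2 zero_le)
    have h4 := hφ x y
    rw [← h3, lengthDist_self (φ x).2, ENNReal.ofReal_eq_zero] at h4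
    linarith
  have hnt := ne_top_of_le_ne_top ENNReal.ofReal_ne_top hxy
  rw [ENNReal.div_le_iff hne hnt, ← hφ] at h1
  have h2 := h1.trans (mul_le_mul_right hxy _)
  rw [← ENNReal.ofReal_mul hδ0, ENNReal.ofReal_le_ofReal_iff (by positivity)] at h2
  linarith

theorem mainTheorem2 (N : ℕ) (G : Set (EuclideanSpace ℝ (Fin N)))
    (hG : IsEmbeddedMetricGraph G) (hGcompact : IsCompact G) (hGconn : IsConnected G)
    (ξ : ℝ) (hξ : ξ ∈ Set.Ioo (0 : ℝ) (1 / 4))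
    (β : ℝ) (hβ : 0 < β) (hβℓ : ENNReal.ofReal β < systole G / 4)
    (ε : ℝ) (hε : 0 < ε) (hεβ : ε ≤ β / 3)
    (hδ : largeScaleDistortion G ε β ≤ ENNReal.ofReal ((1 + 2 * ξ) / (1 + ξ)))
    (S : Set (EuclideanSpace ℝ (Fin N)))
    (hS : Metric.hausdorffEDist G S < ENNReal.ofReal (ξ * ε / 2)) :
    Nonempty (GeometricRealization (epsPathRips S ε β) ≃ₕ G) := by
  obtain ⟨X, _, _, φ, hφ, hgeod⟩ := hG.exists_lengthSpace hGconn
  obtain ⟨hξ0, hξ1⟩ := hξ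
  have : Nonempty X := (hGconn.nonempty.coe_sort).map φ.symm
  have hφ1 : ∀ x y, dist (φ x : EuclideanSpace ℝ (Fin N)) (φ y) ≤ dist x y := by
    intro x y
    have := edist_le_lengthDist G (φ x : EuclideanSpace ℝ (Fin N)) (φ y)
    rwa [← hφ, edist_dist, ENNReal.ofReal_le_ofReal_iff dist_nonneg] at this
  have hβ' : 0 < ENNReal.ofReal β := ENNReal.ofReal_pos.2 hβ
  have hξε : ξ * ε ≤ β / 12 := by nlinarith
  have hξε0 : 0 < ξ * ε := mul_pos hξ0 hε
  -- The treelike property needs loops of length at least 3D = 3.9β, and the systole exceeds 4β.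
  have htree : IsTreelike X (13 / 10 * β) := by
    refine isTreelike_of_loops hgeod fun x γ hγ => ?_
    refine le_trans ?_ (systole_le_curveLength hφ1
      (Subtype.val_injective.comp φ.injective) (fun x => (φ x).2) γ hγ)
    have h1 := (ENNReal.le_div_iff_mul_le (by simp) (by simp)).1 hβℓ.le
    refine le_trans ?_ h1
    rw [show (4 : ℝ≥0∞) = ENNReal.ofReal 4 by simp, ← ENNReal.ofReal_mul hβ.le]
    exact ENNReal.ofReal_le_ofReal (by linarith)
  let κ := ξ * ε / 2
  have hκ : κ ≤ ε / 2 := by simp only [κ]; nlinarith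
  have hSG : ∀ p ∈ S, ∃ x ∈ G, dist p x < κ := by
    intro p hp
    rw [Metric.hausdorffEDist_comm] at hS
    obtain ⟨x, hx, h⟩ := Metric.exists_edist_lt_of_hausdorffEDist_lt hp hS
    exact ⟨x, hx, by rwa [edist_lt_ofReal] at h⟩
  have hGS : ∀ x : X, ∃ p : S, dist (p : EuclideanSpace ℝ (Fin N)) (φ x) < κ := by
    intro x
    obtain ⟨p, hp, h⟩ := Metric.exists_edist_lt_of_hausdorffEDist_lt (φ x).2 hS
    exact ⟨⟨p, hp⟩, by rwa [edist_lt_ofReal, dist_comm] at h⟩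
  -- Since ξ < 1/4, the relative error 2κ/(ε - 2κ) = ξ/(1 - ξ) is below 1/3, and 2κ = ξε ≤ β/12. The
  -- ε-path has length at most (0.68 · 4/3 + 1/12)β = 0.99β.
  have hclose : ∀ p q : S, ∀ x y : X, dist (p : EuclideanSpace ℝ (Fin N)) (φ x) < κ →
      dist (q : EuclideanSpace ℝ (Fin N)) (φ y) < κ → dist x y ≤ 68 / 100 * β →
      epsPathDist S ε p q < ENNReal.ofReal β := by
    intro p q x y hp hq hxy
    obtain ⟨α, h0, h1, hα⟩ := hgeod x y
    have hκε : 2 * κ < ε := by simp only [κ]; nlinarith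
    refine (epsPathDist_le_of_isGeodesic hφ1 hκε hGS dist_nonneg hα (by rwa [h0])
      (by rwa [h1])).trans_lt ((ENNReal.ofReal_lt_ofReal_iff hβ).2 ?_)
    have hd : 0 ≤ dist x y := dist_nonneg
    have h2 : 2 * κ * (dist x y / (ε - 2 * κ)) ≤ dist x y / 3 := by
      have h3 : 0 < ε - 2 * κ := by linarith
      rw [← mul_div_assoc, div_le_iff₀ h3]
      have h4 : 2 * κ ≤ (ε - 2 * κ) / 3 := by simp only [κ]; nlinarith
      nlinarith
    have h5 : 2 * κ ≤ β / 12 := by simp only [κ]; linarith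
    rw [mul_add, mul_one]
    linarith
  refine Nonempty.map (fun e => e.trans φ.toHomotopyEquiv)
    (GeometricRealization.nonempty_homotopyEquiv_of_isTreelike (K := epsPathRips S ε β)
      (D := 13 / 10 * β) (r := 68 / 100 * β) (by linarith) (by linarith) htree
      -- Symmetrizing the relation makes its symmetry immediate and does not change the simplices,
      -- as the diameter runs over all ordered pairs.
      (adj := fun p q => epsPathDist S ε p q < ENNReal.ofReal β ∧
        epsPathDist S ε q p < ENNReal.ofReal β) ?_ (fun p q h => h.symm)
      (N := fun p x => dist (p : EuclideanSpace ℝ (Fin N)) (φ x) < κ) ?_ hGS ?_ ?_)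
  · intro s
    refine (mem_faces_vietorisRips hβ' s).trans (and_congr_right fun _ => ?_)
    exact ⟨fun h p hp q hq => ⟨h p hp q hq, h q hq p hp⟩, fun h p hp q hq => (h p hp q hq).1⟩
  · intro p
    obtain ⟨x, hx, h⟩ := hSG p p.2
    exact ⟨φ.symm ⟨x, hx⟩, by simpa using h⟩
  · rintro p q x y ⟨hpq, -⟩ hp hq
    refine dist_lt_of_largeScaleDistortion_le hφ hβ (by linarith) (by positivity) hδ
      (M := β + 2 * κ) (by simp only [κ]; linarith) ?_ ?_
    -- Since 2κ ≤ ξβ/3, the claim reduces to (1 + 2ξ)(1 + ξ/3)/(1 + ξ) < 1.3. The left side equals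
    -- 1.3 exactly at ξ = 1/4, which explains the choice of D.
    · rw [div_mul_eq_mul_div, div_lt_iff₀ (by linarith)]
      have : 2 * κ ≤ ξ * (β / 3) := by
        simp only [κ]; nlinarith
      nlinarith [mul_pos hξ0 hβ, mul_pos (mul_pos hξ0 hξ0) hβ,
        mul_pos (mul_pos hξ0 (sub_pos.2 hξ1)) hβ, mul_pos hβ (sub_pos.2 hξ1)]
    · refine (lengthDist_thickening_le hκ hSG p q (φ x).2 (φ y).2 hp hq).trans ?_
      rw [ENNReal.ofReal_add hβ.le (by simp only [κ]; linarith)]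
      exact add_le_add hpq.le le_rfl
  · intro p q x y hp hq hxy
    exact ⟨hclose p q x y hp hq hxy, hclose q p y x hq hp (by rwa [dist_comm])⟩
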